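/- Let $\mathbf k$ be a field of characteristic $0$ and $A$ a $\mathbf k$-vector space; $\otimes=\otimes_{\mathbf k}$, $\tau(x\otimes y)=y\otimes x$, and $I$ is the identity map. Operations on $A$ are bilinear, coproducts $A\to A\otimes A$ are linear, and all identities are required for all elements. For an operation $*$ write $L_*(a)b=a*b$, $R_*(a)b=b*a$, and $\mathrm{ad}(a)b=[a,b]$. **Algebras and coalgebras.** A *Novikov algebra* $(A,\circ)$ satisfies $(a\circ b)\circ c-a\circ(b\circ c)=(b\circ a)\circ c-b\circ(a\circ c)$ and $(a\circ b)\circ c=(a\circ c)\circ b$. A *PGD-algebra* $(A,\circ,\cdot,[\,,])$ consists of a Novikov algebra $(A,\circ)$, a commutative associative (not necessarily unital) algebra $(A,\cdot)$ and a Lie algebra $(A,[\,,])$ such that $$[a\circ b,c]-[a\circ c,b]+[a,b]\circ c-[a,c]\circ b-a\circ[b,c]=0,\qquad [a,b\cdot c]=[a,b]\cdot c+b\cdot[a,c],$$ $$(a\cdot b)\circ c=a\cdot(b\circ c),\qquad a\circ(b\cdot c)=(a\circ b)\cdot c+b\cdot(a\circ c).$$ Put $a\star b=a\circ b+b\circ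 a$. Dually, $(A,\Delta_1,\Delta_2,\delta_0)$ is a *PGD-coalgebra* if the following hold. - Novikov coalgebra: $(I\otimes\Delta_1)\Delta_1-(\tau\otimes I)(I\otimes\Delta_1)\Delta_1=(\Delta_1\otimes I)\Delta_1-(\tau\otimes I)(\Delta_1\otimes I)\Delta_1$ and $(\tau\otimes I)(I\otimes\Delta_1)\tau\Delta_1=(\Delta_1\otimes I)\Delta_1$. - Cocommutative associative coalgebra: $(\Delta_2\otimes I)\Delta_2=(I\otimes\Delta_2)\Delta_2$ and $\tau\Delta_2=\Delta_2$. - Lie coalgebra: $\delta_0=-\tau\delta_0$ and $(I\otimes\delta_0)\delta_0-(\tau\otimes I)(I\otimes\delta_0)\delta_0=(\delta_0\otimes I)\delta_0$. - $(I\otimes\delta_0)\Delta_1-(\tau\otimes I)(I\otimes\Delta_1)\delta_0+(\tau\otimes I)(I\otimes\delta_0)\tau\Delta_1=(\Delta_1\otimes I)\delta_0+(\delta_0\otimes I)\Delta_1$. - $(I\otimes\Delta_2)\delta_0=(\delta_0\otimes I)\Delta_2+(\tau\otimes I)(I\otimes\delta_0)\Delta_2$. - $(I\otimes\Delta_2)\Delta_1=(\Delta_1\otimes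 I)\Delta_2+(\tau\otimes I)(I\otimes\Delta_1)\Delta_2$ and $(I\otimes\Delta_2)\tau\Delta_1=(\tau\otimes I)(\Delta_1\otimes I)\Delta_2$. **PGD-bialgebras.** $(A,\circ,\cdot,[\,,],\Delta_1,\Delta_2,\delta_0)$ is a *PGD-bialgebra* if $(A,\circ,\cdot,[\,,])$ is a PGD-algebra, $(A,\Delta_1,\Delta_2,\delta_0)$ is a PGD-coalgebra, and for all $a,b\in A$ $$\Delta_1(a\circ b)=(R_\circ(b)\otimes I)\Delta_1(a)+(I\otimes L_\star(a))(\Delta_1(b)+\tau\Delta_1(b)),$$ $$(L_\star(a)\otimes I)\Delta_1(b)-(I\otimes L_\star(a))\tau\Delta_1(b)=(L_\star(b)\otimes I)\Delta_1(a)-(I\otimes L_\star(b))\tau\Delta_1(a),$$ $$(I\otimes R_\circ(a)-R_\circ(a)\otimes I)(\Delta_1(b)+\tau\Delta_1(b))=(I\otimes R_\circ(b)-R_\circ(b)\otimes I)(\Delta_1(a)+\tau\Delta_1(a)),$$ $$\Delta_2(a\cdot b)=(I\otimes L_\cdot(a))\Delta_2(b)+(L_\cdot(b)\otimes I)\Delta_2(a),$$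 $$\delta_0([a,b])=(\mathrm{ad}(a)\otimes I+I\otimes\mathrm{ad}(a))\delta_0(b)-(\mathrm{ad}(b)\otimes I+I\otimes\mathrm{ad}(b))\delta_0(a),$$ $$\delta_0(b\circ a)+\Delta_1([a,b])=(R_\circ(a)\otimes I)\delta_0(b)+(L_\circ(b)\otimes I)\delta_0(a)+(I\otimes L_\star(b))\delta_0(a)+(\mathrm{ad}(a)\otimes I+I\otimes\mathrm{ad}(a))\Delta_1(b)-(I\otimes\mathrm{ad}(b))(\Delta_1(a)+\tau\Delta_1(a)),$$ $$\delta_0(a\cdot b)=(L_\cdot(a)\otimes I)\delta_0(b)+(L_\cdot(b)\otimes I)\delta_0(a)+(I\otimes\mathrm{ad}(a))\Delta_2(b)+(I\otimes\mathrm{ad}(b))\Delta_2(a),$$ $$\Delta_2([a,b])=(\mathrm{ad}(a)\otimes I+I\otimes\mathrm{ad}(a))\Delta_2(b)-(I\otimes L_\cdot(b))\delta_0(a)+(L_\cdot(b)\otimes I)\delta_0(a),$$ $$\Delta_1(a\cdot b)=(L_\cdot(a)\otimes I)\Delta_1(b)-(I\otimes L_\star(b))\Delta_2(a),$$ $$\Delta_2(a\circ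 b)=(R_\circ(b)\otimes I)\Delta_2(a)-(I\otimes L_\cdot(a))(\Delta_1(b)+\tau\Delta_1(b)),$$ $$(L_\circ(a)\otimes I)\Delta_2(b)+(I\otimes L_\circ(b))\Delta_2(a)+(I\otimes L_\cdot(b))\Delta_1(a)+(L_\cdot(a)\otimes I)\tau\Delta_1(b)=0.$$ **Poisson conformal bialgebras.** Let $P$ be a $\mathbf k[\partial]$-module, let $\partial$ act on $P\otimes P$ as $\partial^{\otimes 2}=\partial\otimes I+I\otimes\partial$, and let $P[\lambda]$ be the polynomials in $\lambda$ with coefficients in $P$. A $\mathbf k$-bilinear map $(a,b)\mapsto a_\lambda b$, $P\times P\to P[\lambda]$, is *sesquilinear* if $(\partial a)_\lambda b=-\lambda\,a_\lambda b$ and $a_\lambda(\partial b)=(\partial+\lambda)\,a_\lambda b$. A *Poisson conformal algebra* $(P,[\cdot_\lambda\cdot],\cdot_\lambda\cdot)$ has two sesquilinear maps with $$(a_\lambda b)_{\lambda+\mu}c=a_\lambda(b_\mu c),\quad a_\lambda b=b_{-\lambda-\partial}a,\quad [a_\lambda b]=-[b_{-\lambda-\partial}a],$$ $$[a_\lambda[b_\mu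 c]]=[[a_\lambda b]_{\lambda+\mu}c]+[b_\mu[a_\lambda c]],\quad [a_\lambda(b_\mu c)]=[a_\lambda b]_{\lambda+\mu}c+b_\mu[a_\lambda c].$$ A *Poisson conformal coalgebra* $(P,\delta,\Delta)$ has two $\mathbf k[\partial]$-module homomorphisms $\delta,\Delta:P\to P\otimes P$ with $(I\otimes\Delta)\Delta=(\Delta\otimes I)\Delta$, $\Delta=\tau\Delta$, $\delta=-\tau\delta$, $(I\otimes\delta)\delta-(\tau\otimes I)(I\otimes\delta)\delta=(\delta\otimes I)\delta$ and $(I\otimes\Delta)\delta=(\delta\otimes I)\Delta+(\tau\otimes I)(I\otimes\delta)\Delta$. Write $\mathfrak L(a)_\lambda b=a_\lambda b$, $\mathfrak R(a)_\lambda b=b_{-\lambda-\partial}a$, $\mathfrak{ad}(a)_\lambda b=[a_\lambda b]$; these act on either factor of $P\otimes P$ with values in $(P\otimes P)[\lambda]$, a subscript $-\lambda-\partial^{\otimes 2}$ means that $\lambda$ is replaced by this operator, acting from the left on the coefficients in $P\otimes P$, and maps on $P$ or $P\otimes P$ are extended to polynomials coefficientwise. A *Poisson conformal bialgebra* $(P,[\cdot_\lambda\cdot],\cdot_\lambda\cdot,\delta,\Delta)$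 is a Poisson conformal algebra and a Poisson conformal coalgebra such that for all $a,b\in P$, with $\nu=-\lambda-\partial^{\otimes2}$, $$\delta([a_\lambda b])=(\mathfrak{ad}(a)_\lambda\otimes I+I\otimes\mathfrak{ad}(a)_\lambda)\delta(b)-(\mathfrak{ad}(b)_\nu\otimes I+I\otimes\mathfrak{ad}(b)_\nu)\delta(a),$$ $$\Delta(a_\lambda b)=(I\otimes\mathfrak L(a)_\lambda)\Delta(b)+(\mathfrak R(b)_\nu\otimes I)\Delta(a),$$ $$(\mathfrak L(b)_\nu\otimes I-I\otimes\mathfrak R(b)_\nu)\Delta(a)+\tau(\mathfrak L(a)_\lambda\otimes I-I\otimes\mathfrak R(a)_\lambda)\Delta(b)=0,$$ $$\delta(a_\lambda b)=(\mathfrak L(a)_\lambda\otimes I)\delta(b)+(\mathfrak L(b)_\nu\otimes I)\delta(a)+(I\otimes\mathfrak{ad}(a)_\lambda)\Delta(b)+(I\otimes\mathfrak{ad}(b)_\nu)\Delta(a),$$ $$\Delta([a_\lambda b])=(\mathfrak{ad}(a)_\lambda\otimes I+I\otimes\mathfrak{ad}(a)_\lambda)\Delta(b)-(I\otimes\mathfrak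 L(b)_\nu)\delta(a)+(\mathfrak L(b)_\nu\otimes I)\delta(a).$$ **Theorem 5.11.** Let $(A,\circ,\cdot,[\,,])$ be a PGD-algebra and let $P=\mathbf k[\partial]\otimes A$, with the sesquilinear maps determined by $$[a_\lambda b]=\partial(b\circ a)+\lambda(b\star a)+[a,b],\qquad a_\lambda b=a\cdot b\qquad(a,b\in A).$$ Let $\Delta_1,\Delta_2,\delta_0:A\to A\otimes A$ be linear maps, and let $\delta,\Delta:P\to P\otimes P$ be the $\mathbf k[\partial]$-module homomorphisms determined by $$\delta(a)=(\partial\otimes I)\Delta_1(a)-\tau(\partial\otimes I)\Delta_1(a)+\delta_0(a),\qquad \Delta(a)=\Delta_2(a)\qquad(a\in A).$$ Then $(P,[\cdot_\lambda\cdot],\cdot_\lambda\cdot,\delta,\Delta)$ is a Poisson conformal bialgebra if and only if $(A,\circ,\cdot,[\,,],\Delta_1,\Delta_2,\delta_0)$ is a PGD-bialgebra. -/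

import Mathlib

open scoped TensorProduct Polynomial

noncomputable section

namespace PGD

/-! ### Polynomials with coefficients in a vector space -/

section Poly

variable (k : Type*) [Field k]

/-- `M[λ]`: polynomials in `λ` with coefficients in `M`; `λ ^ n m` is `X ^ n ⊗ₜ m`. -/
abbrev Poly (M : Type*) [AddCommGroup M] [Module k M] : Type _ := k[X] ⊗[k] M

/-- `M[λ, μ]`: polynomials in two variables with coefficients in `M`. -/
abbrev Poly₂ (M : Type*) [AddCommGroup M] [Module k M] : Type _ :=
  MvPolynomial (Fin 2) k ⊗[k] M

variable (M : Type*) [AddCommGroup M] [Module k M]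

/-- The constants `M → M[λ]`. -/
def const : M →ₗ[k] Poly k M := TensorProduct.mk k k[X] M 1

/-- The constants `M → M[λ, μ]`. -/
def const₂ : M →ₗ[k] Poly₂ k M := TensorProduct.mk k (MvPolynomial (Fin 2) k) M 1

/-- Multiplication by `λ` on `M[λ]`. -/
def lam : Module.End k (Poly k M) := (LinearMap.mulLeft k Polynomial.X).rTensor M

/-- Multiplication by `λ` on `M[λ, μ]`. -/
def lam₂ : Module.End k (Poly₂ k M) := (LinearMap.mulLeft k (MvPolynomial.X 0)).rTensor M

/-- Multiplication by `μ` on `M[λ, μ]`. -/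
def mu₂ : Module.End k (Poly₂ k M) := (LinearMap.mulLeft k (MvPolynomial.X 1)).rTensor M

variable {k M}

/-- The substitution `λ ↦ T`: for an operator `T` on `N` and `j : M → N`, the polynomial
`∑ λ ^ n mₙ` in `M[λ]` is sent to `∑ T ^ n (j mₙ)` (powers of `T` act from the left). -/
def subst {N : Type*} [AddCommGroup N] [Module k N] (T : Module.End k N) (j : M →ₗ[k] N) :
    Poly k M →ₗ[k] N :=
  TensorProduct.lift ((LinearMap.lcomp k N j) ∘ₗ (Polynomial.aeval T).toLinearMap)

end Poly

/-! ### Conformal algebras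

A `k[∂]`-module is a module `P` over `k[X]`, with `X` acting as `∂`, whose `k`-structure is the
restriction of the `k[X]`-structure. -/

section Conformal

variable (k : Type*) [Field k] (P : Type*) [AddCommGroup P] [Module k P] [Module k[X] P]
  [IsScalarTower k k[X] P]

/-- The operator `∂` of a `k[∂]`-module. -/
def del : Module.End k P := Algebra.lsmul k k P (Polynomial.X : k[X])

/-- `∂ ⊗ I + I ⊗ ∂`, the action of `∂` on `P ⊗ P`. -/
def del₂ : Module.End k (P ⊗[k] P) := (del k P).rTensor P + (del k P).lTensor P

/-- The action of `∂` on the coefficients of `P[λ]`. -/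
def delPoly : Module.End k (Poly k P) := (del k P).lTensor k[X]

/-- The action of `∂ ⊗ I + I ⊗ ∂` on the coefficients of `(P ⊗ P)[λ]`. -/
def del₂Poly : Module.End k (Poly k (P ⊗[k] P)) := (del₂ k P).lTensor k[X]

/-- A `λ`-product on `P`, i.e. a `k`-bilinear map `P × P → P[λ]`. -/
abbrev LamProd : Type _ := P →ₗ[k] P →ₗ[k] Poly k P

variable {k P}

/-- `(a _S b) _T c` in `P[λ, μ]`, where the inner product is `m` (taken at `S`) and the outer
product is `m'` (taken at `T`). -/
def nestL (m m' : LamProd k P) (S T : Module.End k (Poly₂ k P)) (a b c : P) : Poly₂ k P :=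
  subst S (subst T (const₂ k P) ∘ₗ m'.flip c) (m a b)

/-- `a _S (b _T c)` in `P[λ, μ]`, where the outer product is `m` (taken at `S`) and the inner
product is `m'` (taken at `T`). -/
def nestR (m m' : LamProd k P) (S T : Module.End k (Poly₂ k P)) (a b c : P) : Poly₂ k P :=
  subst T (subst S (const₂ k P) ∘ₗ m a) (m' b c)

/-- The `λ`-product `(a, b) ↦ b _{-λ-∂} a`. -/
def oppProd (m : LamProd k P) : LamProd k P :=
  m.flip.compr₂ (subst (-lam k P - delPoly k P) (const k P))

/-- Conformal sesquilinearity: `(∂a) _λ b = -λ (a _λ b)` and `a _λ (∂b) = (∂ + λ) (a _λ b)`. -/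
structure IsSesquilinear (m : LamProd k P) : Prop where
  del_left : ∀ a b, m (del k P a) b = -lam k P (m a b)
  del_right : ∀ a b, m a (del k P b) = (delPoly k P + lam k P) (m a b)

structure IsAssocConformalAlgebra (m : LamProd k P) : Prop extends IsSesquilinear m where
  /-- `(a _λ b) _{λ+μ} c = a _λ (b _μ c)` -/
  assoc : ∀ a b c,
    nestL m m (lam₂ k P) (lam₂ k P + mu₂ k P) a b c = nestR m m (lam₂ k P) (mu₂ k P) a b c

structure IsCommAssocConformalAlgebra (m : LamProd k P) : Prop
    extends IsAssocConformalAlgebra m where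
  /-- `a _λ b = b _{-λ-∂} a` -/
  comm : ∀ a b, m a b = oppProd m a b

structure IsLieConformalAlgebra (br : LamProd k P) : Prop extends IsSesquilinear br where
  /-- `[a _λ b] = -[b _{-λ-∂} a]` -/
  skew : ∀ a b, br a b = -oppProd br a b
  /-- `[a _λ [b _μ c]] = [[a _λ b] _{λ+μ} c] + [b _μ [a _λ c]]` -/
  jacobi : ∀ a b c,
    nestR br br (lam₂ k P) (mu₂ k P) a b c =
      nestL br br (lam₂ k P) (lam₂ k P + mu₂ k P) a b c +
        nestR br br (mu₂ k P) (lam₂ k P) b a c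

structure IsPoissonConformalAlgebra (br m : LamProd k P) : Prop where
  lie : IsLieConformalAlgebra br
  commAssoc : IsCommAssocConformalAlgebra m
  /-- `[a _λ (b _μ c)] = [a _λ b] _{λ+μ} c + b _μ [a _λ c]` -/
  leibniz : ∀ a b c,
    nestR br m (lam₂ k P) (mu₂ k P) a b c =
      nestL br m (lam₂ k P) (lam₂ k P + mu₂ k P) a b c +
        nestR m br (mu₂ k P) (lam₂ k P) b a c

end Conformal

/-! ### Composites of coproducts -/

section Coproducts

variable {k : Type*} [Field k] {V : Type*} [AddCommGroup V] [Module k V]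

/-- The flip `τ` of `V ⊗ V`. -/
abbrev flip₂ : V ⊗[k] V →ₗ[k] V ⊗[k] V := (TensorProduct.comm k V V).toLinearMap

/-- `τ ⊗ I` on `V ⊗ V ⊗ V`, that is `x ⊗ (y ⊗ z) ↦ y ⊗ (x ⊗ z)`. -/
abbrev flip₁₂ : V ⊗[k] (V ⊗[k] V) →ₗ[k] V ⊗[k] (V ⊗[k] V) :=
  (TensorProduct.leftComm k V V V).toLinearMap

/-- `I ⊗ Δ : V ⊗ V → V ⊗ V ⊗ V`. -/
def coR (Δ : V →ₗ[k] V ⊗[k] V) : V ⊗[k] V →ₗ[k] V ⊗[k] (V ⊗[k] V) := Δ.lTensor V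

/-- `Δ ⊗ I : V ⊗ V → V ⊗ V ⊗ V` (reassociated to the right). -/
def coL (Δ : V →ₗ[k] V ⊗[k] V) : V ⊗[k] V →ₗ[k] V ⊗[k] (V ⊗[k] V) :=
  (TensorProduct.assoc k V V V).toLinearMap ∘ₗ Δ.rTensor V

end Coproducts

/-! ### Conformal coalgebras and bialgebras -/

section ConformalBialgebra

variable {k : Type*} [Field k] {P : Type*} [AddCommGroup P] [Module k P] [Module k[X] P]
  [IsScalarTower k k[X] P]

/-- `Δ : P → P ⊗ P` is a homomorphism of `k[∂]`-modules. -/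
def IsDelHom (Δ : P →ₗ[k] P ⊗[k] P) : Prop := ∀ a, Δ (del k P a) = del₂ k P (Δ a)

structure IsAssocConformalCoalgebra (Δ : P →ₗ[k] P ⊗[k] P) : Prop where
  del_hom : IsDelHom Δ
  coassoc : ∀ a, coR Δ (Δ a) = coL Δ (Δ a)

structure IsCocommAssocConformalCoalgebra (Δ : P →ₗ[k] P ⊗[k] P) : Prop
    extends IsAssocConformalCoalgebra Δ where
  cocomm : ∀ a, Δ a = flip₂ (Δ a)

structure IsLieConformalCoalgebra (δ : P →ₗ[k] P ⊗[k] P) : Prop where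
  del_hom : IsDelHom δ
  coskew : ∀ a, δ a = -flip₂ (δ a)
  cojacobi : ∀ a, coR δ (δ a) - flip₁₂ (coR δ (δ a)) = coL δ (δ a)

structure IsPoissonConformalCoalgebra (δ Δ : P →ₗ[k] P ⊗[k] P) : Prop where
  lie : IsLieConformalCoalgebra δ
  cocommAssoc : IsCocommAssocConformalCoalgebra Δ
  coleibniz : ∀ a, coR Δ (δ a) = coL δ (Δ a) + flip₁₂ (coR δ (Δ a))

/-- `m(a)_T ⊗ I : P ⊗ P → (P ⊗ P)[λ]`, where `m(a)_λ x = a _λ x`. If `a _λ x = ∑ λ ^ n xₙ`, then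
`x ⊗ y` is sent to `∑ T ^ n (xₙ ⊗ y)`. -/
def actL (m : LamProd k P) (T : Module.End k (Poly k (P ⊗[k] P))) (a : P) :
    P ⊗[k] P →ₗ[k] Poly k (P ⊗[k] P) :=
  subst T (const k (P ⊗[k] P)) ∘ₗ (TensorProduct.assoc k k[X] P P).toLinearMap ∘ₗ (m a).rTensor P

/-- `I ⊗ m(a)_T : P ⊗ P → (P ⊗ P)[λ]`, where `m(a)_λ y = a _λ y`. If `a _λ y = ∑ λ ^ n yₙ`, then
`x ⊗ y` is sent to `∑ T ^ n (x ⊗ yₙ)`. -/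
def actR (m : LamProd k P) (T : Module.End k (Poly k (P ⊗[k] P))) (a : P) :
    P ⊗[k] P →ₗ[k] Poly k (P ⊗[k] P) :=
  subst T (const k (P ⊗[k] P)) ∘ₗ (TensorProduct.leftComm k P k[X] P).toLinearMap ∘ₗ
    (m a).lTensor P

variable (k P) in
/-- `λ` as an operator on `(P ⊗ P)[λ]`. -/
abbrev lamT : Module.End k (Poly k (P ⊗[k] P)) := lam k (P ⊗[k] P)

variable (k P) in
/-- `-λ - (∂ ⊗ I + I ⊗ ∂)` as an operator on `(P ⊗ P)[λ]`. -/
abbrev negLamDel : Module.End k (Poly k (P ⊗[k] P)) := -lam k (P ⊗[k] P) - del₂Poly k P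

/-- Antisymmetric infinitesimal (ASI) conformal bialgebras. Here `oppProd m` is the
right multiplication `(a, b) ↦ b _{-λ-∂} a`. -/
structure IsASIConformalBialgebra (m : LamProd k P) (Δ : P →ₗ[k] P ⊗[k] P) : Prop where
  alg : IsAssocConformalAlgebra m
  coalg : IsAssocConformalCoalgebra Δ
  compat₁ : ∀ a b,
    Δ.lTensor k[X] (m a b) =
      actR m (lamT k P) a (Δ b) + actL (oppProd m) (negLamDel k P) b (Δ a)
  compat₂ : ∀ a b,
    (actL m (negLamDel k P) b (Δ a) - actR (oppProd m) (negLamDel k P) b (Δ a)) +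
      (flip₂ (k := k) (V := P)).lTensor k[X]
        (actL m (lamT k P) a (Δ b) - actR (oppProd m) (lamT k P) a (Δ b)) = 0

structure IsCommCocommASIConformalBialgebra (m : LamProd k P) (Δ : P →ₗ[k] P ⊗[k] P) : Prop
    extends IsASIConformalBialgebra m Δ where
  comm : ∀ a b, m a b = oppProd m a b
  cocomm : ∀ a, Δ a = flip₂ (Δ a)

structure IsLieConformalBialgebra (br : LamProd k P) (δ : P →ₗ[k] P ⊗[k] P) : Prop where
  alg : IsLieConformalAlgebra br
  coalg : IsLieConformalCoalgebra δ
  compat : ∀ a b,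
    δ.lTensor k[X] (br a b) =
      (actL br (lamT k P) a (δ b) + actR br (lamT k P) a (δ b)) -
        (actL br (negLamDel k P) b (δ a) + actR br (negLamDel k P) b (δ a))

structure IsPoissonConformalBialgebra (br m : LamProd k P) (δ Δ : P →ₗ[k] P ⊗[k] P) :
    Prop where
  alg : IsPoissonConformalAlgebra br m
  coalg : IsPoissonConformalCoalgebra δ Δ
  lie : IsLieConformalBialgebra br δ
  asi : IsCommCocommASIConformalBialgebra m Δ
  compat₁ : ∀ a b,
    δ.lTensor k[X] (m a b) =
      actL m (lamT k P) a (δ b) + actL m (negLamDel k P) b (δ a) +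
        actR br (lamT k P) a (Δ b) + actR br (negLamDel k P) b (Δ a)
  compat₂ : ∀ a b,
    Δ.lTensor k[X] (br a b) =
      (actL br (lamT k P) a (Δ b) + actR br (lamT k P) a (Δ b)) -
        actR m (negLamDel k P) b (δ a) + actL m (negLamDel k P) b (δ a)

end ConformalBialgebra

/-! ### PGD-algebras, PGD-coalgebras and PGD-bialgebras -/

section Finite

variable {k : Type*} [Field k] {A : Type*} [AddCommGroup A] [Module k A]

/-- Novikov algebras. -/
structure IsNovikovAlgebra (circ : A →ₗ[k] A →ₗ[k] A) : Prop where
  left_symm : ∀ a b c,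
    circ (circ a b) c - circ a (circ b c) = circ (circ b a) c - circ b (circ a c)
  right_comm : ∀ a b c, circ (circ a b) c = circ (circ a c) b

structure IsLieAlg (br : A →ₗ[k] A →ₗ[k] A) : Prop where
  self : ∀ a, br a a = 0
  jacobi : ∀ a b c, br a (br b c) = br (br a b) c + br b (br a c)

structure IsCommAssocAlg (dot : A →ₗ[k] A →ₗ[k] A) : Prop where
  comm : ∀ a b, dot a b = dot b a
  assoc : ∀ a b c, dot (dot a b) c = dot a (dot b c)

/-- Gel'fand-Dorfman algebras. -/
structure IsGDAlgebra (circ br : A →ₗ[k] A →ₗ[k] A) : Prop where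
  lie : IsLieAlg br
  novikov : IsNovikovAlgebra circ
  compat : ∀ a b c,
    br (circ a b) c - br (circ a c) b + circ (br a b) c - circ (br a c) b - circ a (br b c) = 0

structure IsPoissonAlgebra (dot br : A →ₗ[k] A →ₗ[k] A) : Prop where
  commAssoc : IsCommAssocAlg dot
  lie : IsLieAlg br
  leibniz : ∀ a b c, br a (dot b c) = dot (br a b) c + dot b (br a c)

/-- Differential Novikov-Poisson algebras. -/
structure IsDiffNovikovPoissonAlgebra (circ dot : A →ₗ[k] A →ₗ[k] A) : Prop where
  novikov : IsNovikovAlgebra circ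
  commAssoc : IsCommAssocAlg dot
  compat₁ : ∀ a b c, circ (dot a b) c = dot a (circ b c)
  compat₂ : ∀ a b c, circ a (dot b c) = dot (circ a b) c + dot b (circ a c)

/-- Poisson-Gel'fand-Dorfman (PGD) algebras. -/
structure IsPGDAlgebra (circ dot br : A →ₗ[k] A →ₗ[k] A) : Prop where
  gd : IsGDAlgebra circ br
  poisson : IsPoissonAlgebra dot br
  dnp : IsDiffNovikovPoissonAlgebra circ dot

structure IsNovikovCoalgebra (Δ : A →ₗ[k] A ⊗[k] A) : Prop where
  left_symm : ∀ a,
    coR Δ (Δ a) - flip₁₂ (coR Δ (Δ a)) = coL Δ (Δ a) - flip₁₂ (coL Δ (Δ a))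
  right_comm : ∀ a, flip₁₂ (coR Δ (flip₂ (Δ a))) = coL Δ (Δ a)

structure IsCocommAssocCoalgebra (Δ : A →ₗ[k] A ⊗[k] A) : Prop where
  coassoc : ∀ a, coL Δ (Δ a) = coR Δ (Δ a)
  cocomm : ∀ a, Δ a = flip₂ (Δ a)

structure IsLieCoalg (δ : A →ₗ[k] A ⊗[k] A) : Prop where
  coskew : ∀ a, δ a = -flip₂ (δ a)
  cojacobi : ∀ a, coR δ (δ a) - flip₁₂ (coR δ (δ a)) = coL δ (δ a)

structure IsGDCoalgebra (Δ δ : A →ₗ[k] A ⊗[k] A) : Prop where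
  novikov : IsNovikovCoalgebra Δ
  lie : IsLieCoalg δ
  compat : ∀ a,
    coR δ (Δ a) - flip₁₂ (coR Δ (δ a)) + flip₁₂ (coR δ (flip₂ (Δ a))) =
      coL Δ (δ a) + coL δ (Δ a)

structure IsPoissonCoalgebra (Δ δ : A →ₗ[k] A ⊗[k] A) : Prop where
  cocommAssoc : IsCocommAssocCoalgebra Δ
  lie : IsLieCoalg δ
  coleibniz : ∀ a, coR Δ (δ a) = coL δ (Δ a) + flip₁₂ (coR δ (Δ a))

structure IsDiffNovikovPoissonCoalgebra (Δ₁ Δ₂ : A →ₗ[k] A ⊗[k] A) : Prop where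
  novikov : IsNovikovCoalgebra Δ₁
  cocommAssoc : IsCocommAssocCoalgebra Δ₂
  compat₁ : ∀ a, coR Δ₂ (Δ₁ a) = coL Δ₁ (Δ₂ a) + flip₁₂ (coR Δ₁ (Δ₂ a))
  compat₂ : ∀ a, coR Δ₂ (flip₂ (Δ₁ a)) = flip₁₂ (coL Δ₁ (Δ₂ a))

/-- `T ⊗ I` on `A ⊗ A`. -/
abbrev onL (T : A →ₗ[k] A) : A ⊗[k] A →ₗ[k] A ⊗[k] A := T.rTensor A

/-- `I ⊗ T` on `A ⊗ A`. -/
abbrev onR (T : A →ₗ[k] A) : A ⊗[k] A →ₗ[k] A ⊗[k] A := T.lTensor A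

/-- `a ⋆ b = a ∘ b + b ∘ a`. Left multiplication by `a` is `star circ a`. -/
def star (circ : A →ₗ[k] A →ₗ[k] A) : A →ₗ[k] A →ₗ[k] A := circ + circ.flip

/-- Novikov bialgebras. Here `circ.flip b` is right multiplication by `b`. -/
structure IsNovikovBialgebra (circ : A →ₗ[k] A →ₗ[k] A) (Δ : A →ₗ[k] A ⊗[k] A) : Prop where
  alg : IsNovikovAlgebra circ
  coalg : IsNovikovCoalgebra Δ
  compat₁ : ∀ a b,
    Δ (circ a b) = onL (circ.flip b) (Δ a) + onR (star circ a) (Δ b + flip₂ (Δ b))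
  compat₂ : ∀ a b,
    onL (star circ a) (Δ b) - onR (star circ a) (flip₂ (Δ b)) =
      onL (star circ b) (Δ a) - onR (star circ b) (flip₂ (Δ a))
  compat₃ : ∀ a b,
    onR (circ.flip a) (Δ b + flip₂ (Δ b)) - onL (circ.flip a) (Δ b + flip₂ (Δ b)) =
      onR (circ.flip b) (Δ a + flip₂ (Δ a)) - onL (circ.flip b) (Δ a + flip₂ (Δ a))

/-- Commutative and cocommutative antisymmetric infinitesimal (ASI) bialgebras. -/
structure IsCommCocommASIBialgebra (dot : A →ₗ[k] A →ₗ[k] A) (Δ : A →ₗ[k] A ⊗[k] A) :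
    Prop where
  alg : IsCommAssocAlg dot
  coalg : IsCocommAssocCoalgebra Δ
  compat : ∀ a b, Δ (dot a b) = onR (dot a) (Δ b) + onL (dot b) (Δ a)

structure IsLieBialg (br : A →ₗ[k] A →ₗ[k] A) (δ : A →ₗ[k] A ⊗[k] A) : Prop where
  alg : IsLieAlg br
  coalg : IsLieCoalg δ
  compat : ∀ a b,
    δ (br a b) =
      (onL (br a) (δ b) + onR (br a) (δ b)) - (onL (br b) (δ a) + onR (br b) (δ a))

/-- Gel'fand-Dorfman bialgebras. -/
structure IsGDBialgebra (circ br : A →ₗ[k] A →ₗ[k] A) (Δ δ : A →ₗ[k] A ⊗[k] A) : Prop where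
  alg : IsGDAlgebra circ br
  coalg : IsGDCoalgebra Δ δ
  novikov : IsNovikovBialgebra circ Δ
  lie : IsLieBialg br δ
  compat : ∀ a b,
    δ (circ b a) + Δ (br a b) =
      onL (circ.flip a) (δ b) + onL (circ b) (δ a) + onR (star circ b) (δ a) +
        (onL (br a) (Δ b) + onR (br a) (Δ b)) - onR (br b) (Δ a + flip₂ (Δ a))

structure IsPoissonBialgebra (dot br : A →ₗ[k] A →ₗ[k] A) (Δ δ : A →ₗ[k] A ⊗[k] A) :
    Prop where
  alg : IsPoissonAlgebra dot br
  coalg : IsPoissonCoalgebra Δ δ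
  asi : IsCommCocommASIBialgebra dot Δ
  lie : IsLieBialg br δ
  compat₁ : ∀ a b,
    δ (dot a b) =
      onL (dot a) (δ b) + onL (dot b) (δ a) + onR (br a) (Δ b) + onR (br b) (Δ a)
  compat₂ : ∀ a b,
    Δ (br a b) =
      (onL (br a) (Δ b) + onR (br a) (Δ b)) - onR (dot b) (δ a) + onL (dot b) (δ a)

/-- Differential Novikov-Poisson bialgebras. -/
structure IsDiffNovikovPoissonBialgebra (circ dot : A →ₗ[k] A →ₗ[k] A)
    (Δ₁ Δ₂ : A →ₗ[k] A ⊗[k] A) : Prop where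
  alg : IsDiffNovikovPoissonAlgebra circ dot
  coalg : IsDiffNovikovPoissonCoalgebra Δ₁ Δ₂
  novikov : IsNovikovBialgebra circ Δ₁
  asi : IsCommCocommASIBialgebra dot Δ₂
  compat₁ : ∀ a b, Δ₁ (dot a b) = onL (dot a) (Δ₁ b) - onR (star circ b) (Δ₂ a)
  compat₂ : ∀ a b,
    Δ₂ (circ a b) = onL (circ.flip b) (Δ₂ a) - onR (dot a) (Δ₁ b + flip₂ (Δ₁ b))
  compat₃ : ∀ a b,
    onL (circ a) (Δ₂ b) + onR (circ b) (Δ₂ a) + onR (dot b) (Δ₁ a) +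
      onL (dot a) (flip₂ (Δ₁ b)) = 0

/-- Poisson-Gel'fand-Dorfman (PGD) bialgebras `(A, ∘, ·, [,], Δ₁, Δ₂, δ)`. -/
structure IsPGDBialgebra (circ dot br : A →ₗ[k] A →ₗ[k] A) (Δ₁ Δ₂ δ : A →ₗ[k] A ⊗[k] A) :
    Prop where
  gd : IsGDBialgebra circ br Δ₁ δ
  poisson : IsPoissonBialgebra dot br Δ₂ δ
  dnp : IsDiffNovikovPoissonBialgebra circ dot Δ₁ Δ₂

end Finite

/-! ### The free `k[∂]`-module `k[∂] ⊗ A` and its structures -/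

section Free

variable (k : Type*) [Field k] (A : Type*) [AddCommGroup A] [Module k A]

/-- `k[∂] ⊗ A`, the free `k[∂]`-module on `A`. -/
def Free : Type _ := k[X] ⊗[k] A

instance : AddCommGroup (Free k A) := inferInstanceAs (AddCommGroup (k[X] ⊗[k] A))

instance : Module k (Free k A) := inferInstanceAs (Module k (k[X] ⊗[k] A))

instance : Module k[X] (Free k A) := inferInstanceAs (Module k[X] (k[X] ⊗[k] A))

instance : IsScalarTower k k[X] (Free k A) := inferInstanceAs (IsScalarTower k k[X] (k[X] ⊗[k] A))

/-- The identity, as a `k[∂]`-linear isomorphism. -/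
def freeEquiv : Free k A ≃ₗ[k[X]] k[X] ⊗[k] A := LinearEquiv.refl k[X] (k[X] ⊗[k] A)

/-- The bilinear map `(f, a) ↦ f(∂) a = f ⊗ a`. -/
def freeMk : k[X] →ₗ[k] A →ₗ[k] Free k A :=
  (TensorProduct.mk k k[X] A).compr₂ ((freeEquiv k A).symm.toLinearMap.restrictScalars k)

/-- The inclusion `A → k[∂] ⊗ A`, `a ↦ 1 ⊗ a`. -/
def incl : A →ₗ[k] Free k A := freeMk k A 1

variable {k A}

/-- The linear map on `k[∂] ⊗ A` that sends `f(∂) a` to `F f a`. -/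
def freeLift {N : Type*} [AddCommMonoid N] [Module k N] (F : k[X] →ₗ[k] A →ₗ[k] N) :
    Free k A →ₗ[k] N :=
  TensorProduct.lift F ∘ₗ (freeEquiv k A).toLinearMap.restrictScalars k

@[simp] theorem freeLift_mk {N : Type*} [AddCommMonoid N] [Module k N]
    (F : k[X] →ₗ[k] A →ₗ[k] N) (f : k[X]) (a : A) : freeLift F (freeMk k A f a) = F f a := by
  simp [freeLift, freeMk]

theorem free_ext {N : Type*} [AddCommMonoid N] [Module k N] {F G : Free k A →ₗ[k] N}
    (h : ∀ f a, F (freeMk k A f a) = G (freeMk k A f a)) : F = G :=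
  TensorProduct.ext' (M := k[X]) (N := A) h

/-- The sesquilinear extension of `β : A × A → P[λ]` to `P = k[∂] ⊗ A`:
`(f(∂) a) _λ (g(∂) b) = f(-λ) g(λ + ∂) β(a, b)`. -/
def sesqExt (β : A →ₗ[k] A →ₗ[k] Poly k (Free k A)) : LamProd k (Free k A) :=
  freeLift <| LinearMap.mk₂ k
    (fun f a => freeLift <| LinearMap.mk₂ k
      (fun g b =>
        Polynomial.aeval (-lam k (Free k A)) f
          (Polynomial.aeval (lam k (Free k A) + delPoly k (Free k A)) g (β a b)))
      (by intros; simp) (by intros; simp) (by intros; simp) (by intros; simp))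
    (by intros; apply free_ext; intros; simp) (by intros; apply free_ext; intros; simp)
    (by intros; apply free_ext; intros; simp) (by intros; apply free_ext; intros; simp)

/-- The `k[∂]`-linear extension of `D : A → P ⊗ P` to `P = k[∂] ⊗ A`. -/
def delExt (D : A →ₗ[k] Free k A ⊗[k] Free k A) : Free k A →ₗ[k] Free k A ⊗[k] Free k A :=
  freeLift ((LinearMap.lcomp k _ D) ∘ₗ (Polynomial.aeval (del₂ k (Free k A))).toLinearMap)

/-- The `λ`-bracket of `k[∂] ⊗ A`: `[a _λ b] = ∂(b ∘ a) + λ(b ⋆ a) + [a, b]` for `a, b ∈ A`. -/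
def corrBracket (circ br : A →ₗ[k] A →ₗ[k] A) : LamProd k (Free k A) :=
  sesqExt
    (circ.flip.compr₂ (const k (Free k A) ∘ₗ del k (Free k A) ∘ₗ incl k A) +
      (star circ).flip.compr₂ (lam k (Free k A) ∘ₗ const k (Free k A) ∘ₗ incl k A) +
      br.compr₂ (const k (Free k A) ∘ₗ incl k A))

/-- The `λ`-product of `k[∂] ⊗ A`: `a _λ b = a · b` for `a, b ∈ A`. -/
def corrProd (dot : A →ₗ[k] A →ₗ[k] A) : LamProd k (Free k A) :=
  sesqExt (dot.compr₂ (const k (Free k A) ∘ₗ incl k A))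

/-- The inclusion `A ⊗ A → P ⊗ P` for `P = k[∂] ⊗ A`. -/
def incl₂ : A ⊗[k] A →ₗ[k] Free k A ⊗[k] Free k A := TensorProduct.map (incl k A) (incl k A)

/-- `δ(a) = (∂ ⊗ I) Δ₁(a) - τ (∂ ⊗ I) Δ₁(a) + δ₀(a)` for `a ∈ A`, extended to `k[∂] ⊗ A`. -/
def corrCobracket (Δ₁ δ₀ : A →ₗ[k] A ⊗[k] A) : Free k A →ₗ[k] Free k A ⊗[k] Free k A :=
  delExt
    ((del k (Free k A)).rTensor (Free k A) ∘ₗ incl₂ ∘ₗ Δ₁ -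
      flip₂ ∘ₗ (del k (Free k A)).rTensor (Free k A) ∘ₗ incl₂ ∘ₗ Δ₁ + incl₂ ∘ₗ δ₀)

/-- `Δ(a) = Δ₂(a)` for `a ∈ A`, extended to `k[∂] ⊗ A`. -/
def corrComul (Δ₂ : A →ₗ[k] A ⊗[k] A) : Free k A →ₗ[k] Free k A ⊗[k] Free k A :=
  delExt (incl₂ ∘ₗ Δ₂)

end Free

end PGD

end

/-! The proof rests on two facts about `P = k[∂] ⊗ A`. First, `P` is generated by `A` as a
`k[∂]`-module, and in each conformal axiom the difference of the two sides is additive in every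
argument and turns `∂` in an argument into a fixed operator on the value. Hence every axiom for `P`
is equivalent to its restriction to elements of `A` (`free_induction₁`, `free_induction₂`,
`free_induction₃`, `IsSesquilinear₂.ext`).

Second, `P` is free. On elements of `A` the difference is a polynomial of degree at most two in
three operators, with coefficients in a tensor power of `A`. For the coalgebra axioms the operators
are `∂` on the three factors of `P ⊗ P ⊗ P`; for the compatibility conditions they are `λ`, `∂ ⊗ I`,
`I ⊗ ∂` on `(P ⊗ P)[λ]`. Such a polynomial vanishes exactly when its ten coefficients do
(`IsCoeff.quad_eq_zero_iff`). Some of the coefficients are PGD axioms, possibly after a linear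
combination; the others follow from these by permuting tensor factors, exchanging `a` and `b`, and
using skewness or symmetry of the operations and coproducts.

The equivalences obtained in this way are `isPoissonConformalCoalgebra_corr_iff` for the coalgebra,
`lie_compat_iff` for the Lie part, `asi_compat_iff` for the associative part and
`poisson_compat_iff` for the mixed part. The algebra axioms are needed in one direction only,
because `A` is assumed to be a PGD-algebra: `isPoissonConformalAlgebra_corr` writes each coefficient
in `∂`, `λ`, `μ` as a combination of the identities of `A`. The second associative compatibility
condition has no counterpart on the finite side; it follows from the first by commutativity and
cocommutativity (`asi_compat_symm`). -/

noncomputable section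

namespace PGD

/-! ### Calculus of the substitution of an operator for `λ`. -/

section General

variable {k : Type*} [Field k] {M N : Type*} [AddCommGroup M] [Module k M] [AddCommGroup N]
  [Module k N]

theorem lam_tmul (f : k[X]) (x : M) : lam k M (f ⊗ₜ x) = (Polynomial.X * f) ⊗ₜ x := by
  simp [lam]

theorem subst_tmul (T : Module.End k N) (j : M →ₗ[k] N) (f : k[X]) (x : M) :
    subst T j (f ⊗ₜ x) = Polynomial.aeval T f (j x) := by
  simp [subst]

@[simp] theorem subst_const (T : Module.End k N) (j : M →ₗ[k] N) (x : M) :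
    subst T j (const k M x) = j x := by
  simp [const, subst_tmul]

theorem subst_lam (T : Module.End k N) (j : M →ₗ[k] N) (u : Poly k M) :
    subst T j (lam k M u) = T (subst T j u) := by
  induction u using TensorProduct.induction_on with
  | zero => simp
  | add u v hu hv => simp [hu, hv]
  | tmul f x => simp [lam_tmul, subst_tmul]

theorem subst_lTensor {M' : Type*} [AddCommGroup M'] [Module k M'] (T : Module.End k N)
    (j : M →ₗ[k] N) (g : M' →ₗ[k] M) (u : Poly k M') :
    subst T j (g.lTensor k[X] u) = subst T (j ∘ₗ g) u := by
  induction u using TensorProduct.induction_on with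
  | zero => simp
  | add u v hu hv => simp [hu, hv]
  | tmul f x => simp [subst_tmul]

theorem commute_aeval {G T : Module.End k N} (h : Commute G T) (f : k[X]) :
    Commute G (Polynomial.aeval T f) := by
  induction f using Polynomial.induction_on' with
  | add p q hp hq => simpa using hp.add_right hq
  | monomial n c =>
    rw [Polynomial.aeval_monomial]
    exact Commute.mul_right (Algebra.commutes c G).symm (h.pow_right n)

/-- An intertwining relation between `T` and `T'` passes to all powers, hence to all polynomials.
This is what moves `∂`, `λ` and `μ` through nested products and through the actions on `P ⊗ P`. -/
theorem subst_intertwine {N' : Type*} [AddCommGroup N'] [Module k N'] {T : Module.End k N}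
    {T' : Module.End k N'} {G : N →ₗ[k] N'} (h : ∀ x, G (T x) = T' (G x)) (j : M →ₗ[k] N)
    (u : Poly k M) : subst T' (G ∘ₗ j) u = G (subst T j u) := by
  induction u using TensorProduct.induction_on with
  | zero => simp
  | add u v hu hv => simp [hu, hv]
  | tmul f x =>
    simp only [subst_tmul, LinearMap.comp_apply]
    generalize j x = y
    induction f using Polynomial.induction_on' with
    | add p q hp hq => simp [hp, hq]
    | monomial n c =>
      simp only [Polynomial.aeval_monomial, Module.End.mul_apply, Module.algebraMap_end_apply,
        map_smul]
      congr 1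
      induction n with
      | zero => simp
      | succ n ih => simp [pow_succ', ih, h]

theorem lTensor_lam (g : M →ₗ[k] N) (u : Poly k M) :
    g.lTensor k[X] (lam k M u) = lam k N (g.lTensor k[X] u) := by
  induction u using TensorProduct.induction_on with
  | zero => simp
  | add u v hu hv => simp [hu, hv]
  | tmul f x => simp [lam_tmul]

@[simp] theorem lTensor_const (g : M →ₗ[k] N) (x : M) :
    g.lTensor k[X] (const k M x) = const k N (g x) := by
  simp [const]

variable {P : Type*} [AddCommGroup P] [Module k P] [Module k[X] P] [IsScalarTower k k[X] P]

theorem delPoly_const (x : P) : delPoly k P (const k P x) = const k P (del k P x) := by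
  simp [delPoly]

theorem delPoly_lam (u : Poly k P) : delPoly k P (lam k P u) = lam k P (delPoly k P u) :=
  lTensor_lam _ _

theorem subst_delPoly (T : Module.End k N) (j : P →ₗ[k] N) (u : Poly k P) :
    subst T j (delPoly k P u) = subst T (j ∘ₗ del k P) u :=
  subst_lTensor _ _ _ _

end General

/-! ### Generation of `k[∂] ⊗ A` by `A`, and extension of maps from `A`. -/

section FreeModule

variable {k : Type*} [Field k] {A : Type*} [AddCommGroup A] [Module k A]

theorem freeMk_X_mul (f : k[X]) (a : A) :
    freeMk k A (Polynomial.X * f) a = del k (Free k A) (freeMk k A f a) := rfl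

theorem freeMk_induction {p : Free k A → Prop} (hmk : ∀ f a, p (freeMk k A f a))
    (hadd : ∀ x y, p x → p y → p (x + y)) (x : Free k A) : p x := by
  refine TensorProduct.induction_on (motive := p) x ?_ hmk hadd
  have := hmk 0 0
  rwa [map_zero] at this

/-- A monomial `c ∂ ^ n` applied to `a` is `∂ ^ n` applied to `c • a`. Scalars are thus absorbed
into `A`, and closure under sums and `∂` suffices. -/
theorem free_induction {p : Free k A → Prop} (hincl : ∀ a, p (incl k A a))
    (hadd : ∀ x y, p x → p y → p (x + y)) (hdel : ∀ x, p x → p (del k (Free k A) x))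
    (x : Free k A) : p x := by
  refine freeMk_induction (fun f => ?_) hadd x
  induction f using Polynomial.induction_on' with
  | add f g hf hg =>
    intro a; rw [map_add, LinearMap.add_apply]; exact hadd _ _ (hf a) (hg a)
  | monomial n c =>
    induction n with
    | zero =>
      intro a
      have : freeMk k A (Polynomial.monomial 0 c) a = incl k A (c • a) := by
        rw [incl, map_smul, ← LinearMap.smul_apply, ← map_smul, Polynomial.smul_eq_C_mul, mul_one,
          Polynomial.monomial_zero_left]
      rw [this]; exact hincl _
    | succ n ih =>
      intro a
      rw [← Polynomial.X_mul_monomial, freeMk_X_mul]; exact hdel _ (ih a)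

/-- The zeros of `F` in each argument are stable under sums and under `∂`, since `∂` comes out as a
linear operator on the value. In use, `F` is the difference of the two sides of an identity. -/
theorem free_induction₂ {V : Type*} [AddCommGroup V] [Module k V] {F : Free k A → Free k A → V}
    {S T : Module.End k V} (h : ∀ a b, F (incl k A a) (incl k A b) = 0)
    (add_left : ∀ a a' b, F (a + a') b = F a b + F a' b)
    (add_right : ∀ a b b', F a (b + b') = F a b + F a b')
    (del_left : ∀ a b, F (del k _ a) b = S (F a b))
    (del_right : ∀ a b, F a (del k _ b) = T (F a b)) (a b : Free k A) : F a b = 0 := by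
  induction a using free_induction with
  | hadd x y hx hy => rw [add_left, hx, hy, add_zero]
  | hdel x hx => rw [del_left, hx, map_zero]
  | hincl a =>
    induction b using free_induction with
    | hadd x y hx hy => rw [add_right, hx, hy, add_zero]
    | hdel x hx => rw [del_right, hx, map_zero]
    | hincl b => exact h a b

theorem free_induction₃ {V : Type*} [AddCommGroup V] [Module k V]
    {F : Free k A → Free k A → Free k A → V}
    {R S T : Module.End k V} (h : ∀ a b c, F (incl k A a) (incl k A b) (incl k A c) = 0)
    (add₁ : ∀ a a' b c, F (a + a') b c = F a b c + F a' b c)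
    (add₂ : ∀ a b b' c, F a (b + b') c = F a b c + F a b' c)
    (add₃ : ∀ a b c c', F a b (c + c') = F a b c + F a b c')
    (del₁ : ∀ a b c, F (del k _ a) b c = R (F a b c))
    (del₂ : ∀ a b c, F a (del k _ b) c = S (F a b c))
    (del₃ : ∀ a b c, F a b (del k _ c) = T (F a b c)) (a b c : Free k A) : F a b c = 0 := by
  induction a using free_induction with
  | hadd x y hx hy => rw [add₁, hx, hy, add_zero]
  | hdel x hx => rw [del₁, hx, map_zero]
  | hincl a => exact free_induction₂ (h a) (add₂ _) (add₃ _) (del₂ _) (del₃ _) b c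

theorem isSesquilinear_sesqExt (β : A →ₗ[k] A →ₗ[k] Poly k (Free k A)) :
    IsSesquilinear (sesqExt β) where
  del_left a b := by
    induction a using freeMk_induction with
    | hadd x y hx hy => simp only [map_add, LinearMap.add_apply, hx, hy, neg_add]
    | hmk f a =>
      induction b using freeMk_induction with
      | hadd x y hx hy => simp only [map_add, hx, hy, neg_add]
      | hmk g b => simp [sesqExt, ← freeMk_X_mul]
  del_right a b := by
    induction a using freeMk_induction with
    | hadd x y hx hy =>
      rw [map_add, LinearMap.add_apply, LinearMap.add_apply, hx, hy]
      exact (map_add _ _ _).symm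
    | hmk f a =>
      induction b using freeMk_induction with
      | hadd x y hx hy => simp only [map_add, hx, hy]
      | hmk g b =>
        -- In `sesqExt` the factor `f(-λ)` stands to the left of `g(λ + ∂)`, so the new factor `∂ +
        -- λ` has to pass it.
        have hc : Commute (delPoly k (Free k A) + lam k (Free k A))
            (Polynomial.aeval (-lam k (Free k A)) f) := by
          refine commute_aeval (LinearMap.ext fun u => ?_) f
          simp [delPoly_lam, add_comm]
        rw [← freeMk_X_mul]
        simp only [sesqExt, freeLift_mk, LinearMap.mk₂_apply, map_mul, Polynomial.aeval_X,
          Module.End.mul_apply]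
        rw [← Module.End.mul_apply, ← Module.End.mul_apply (delPoly k _ + lam k _), hc.eq,
          add_comm (lam k _)]

theorem sesqExt_incl (β : A →ₗ[k] A →ₗ[k] Poly k (Free k A)) (a b : A) :
    sesqExt β (incl k A a) (incl k A b) = β a b := by
  simp [sesqExt, incl]

theorem isDelHom_delExt (D : A →ₗ[k] Free k A ⊗[k] Free k A) : IsDelHom (delExt D) := by
  intro a
  induction a using freeMk_induction with
  | hadd x y hx hy => simp only [map_add, hx, hy]
  | hmk f a => simp [delExt, ← freeMk_X_mul]

theorem delExt_incl (D : A →ₗ[k] Free k A ⊗[k] Free k A) (a : A) :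
    delExt D (incl k A a) = D a := by
  simp [delExt, incl]

end FreeModule

/-! ### Sesquilinearity rules for the two kinds of nested products. -/

section Nested

variable {k : Type*} [Field k] {P : Type*} [AddCommGroup P] [Module k P]

theorem mu₂_lam₂ (u : Poly₂ k P) : mu₂ k P (lam₂ k P u) = lam₂ k P (mu₂ k P u) := by
  induction u using TensorProduct.induction_on with
  | zero => simp
  | add u v hu hv => simp [hu, hv]
  | tmul f x => simp [lam₂, mu₂, mul_left_comm]

variable {m m' : LamProd k P} {S T : Module.End k (Poly₂ k P)}

/-- The substitution of an element of `P[λ]` for `a _S b` in `(a _S b) _T c`. -/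
def outerL (m' : LamProd k P) (S T : Module.End k (Poly₂ k P)) (c : P) :
    Poly k P →ₗ[k] Poly₂ k P :=
  subst S (subst T (const₂ k P) ∘ₗ m'.flip c)

/-- The substitution of an element of `P[λ]` for `b _T c` in `a _S (b _T c)`. -/
def outerR (m : LamProd k P) (S T : Module.End k (Poly₂ k P)) (a : P) :
    Poly k P →ₗ[k] Poly₂ k P :=
  subst T (subst S (const₂ k P) ∘ₗ m a)

theorem nestL_eq (a b c : P) : nestL m m' S T a b c = outerL m' S T c (m a b) := rfl

theorem nestR_eq (a b c : P) : nestR m m' S T a b c = outerR m S T a (m' b c) := rfl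

theorem outerL_const (c x : P) :
    outerL m' S T c (const k P x) = subst T (const₂ k P) (m' x c) := by
  simp [outerL]

theorem outerL_lam (c : P) (u : Poly k P) :
    outerL m' S T c (lam k P u) = S (outerL m' S T c u) := subst_lam _ _ _

theorem outerR_const (a x : P) :
    outerR m S T a (const k P x) = subst S (const₂ k P) (m a x) := by
  simp [outerR]

theorem outerR_lam (a : P) (u : Poly k P) :
    outerR m S T a (lam k P u) = T (outerR m S T a u) := subst_lam _ _ _

theorem outerL_add_right (c c' : P) (u : Poly k P) :
    outerL m' S T (c + c') u = outerL m' S T c u + outerL m' S T c' u := by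
  induction u using TensorProduct.induction_on with
  | zero => simp
  | add u v hu hv => simp only [map_add, hu, hv]; abel
  | tmul f x => simp [outerL, subst_tmul]

theorem outerR_add_left (a a' : P) (u : Poly k P) :
    outerR m S T (a + a') u = outerR m S T a u + outerR m S T a' u := by
  induction u using TensorProduct.induction_on with
  | zero => simp
  | add u v hu hv => simp only [map_add, hu, hv]; abel
  | tmul f x => simp [outerR, subst_tmul]

variable [Module k[X] P] [IsScalarTower k k[X] P]

variable (k P) in
/-- The action of `∂` on the coefficients of `P[λ, μ]`. -/
def delPoly₂ : Module.End k (Poly₂ k P) := (del k P).lTensor (MvPolynomial (Fin 2) k)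

theorem delPoly₂_lam₂ (u : Poly₂ k P) :
    delPoly₂ k P (lam₂ k P u) = lam₂ k P (delPoly₂ k P u) := by
  induction u using TensorProduct.induction_on with
  | zero => simp
  | add u v hu hv => simp [hu, hv]
  | tmul f x => simp [delPoly₂, lam₂]

theorem delPoly₂_mu₂ (u : Poly₂ k P) :
    delPoly₂ k P (mu₂ k P u) = mu₂ k P (delPoly₂ k P u) := by
  induction u using TensorProduct.induction_on with
  | zero => simp
  | add u v hu hv => simp [hu, hv]
  | tmul f x => simp [delPoly₂, mu₂]

theorem subst_const₂_delPoly (hT : ∀ x, delPoly₂ k P (T x) = T (delPoly₂ k P x)) (u : Poly k P) :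
    subst T (const₂ k P) (delPoly k P u) = delPoly₂ k P (subst T (const₂ k P) u) := by
  rw [subst_delPoly, ← subst_intertwine hT]
  congr 1

/-- The inner value is the left argument of the outer product, so `∂` on it becomes `-T`. -/
theorem outerL_delPoly (hm : IsSesquilinear m') (h : ∀ x, T (S x) = S (T x)) (c : P)
    (u : Poly k P) : outerL m' S T c (delPoly k P u) = -T (outerL m' S T c u) := by
  rw [outerL, subst_delPoly, ← LinearMap.neg_apply,
    ← subst_intertwine (T' := S) (fun x => by simp [h])]
  congr 2
  ext x
  simp [hm.del_left, subst_lam]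

/-- Here the inner value is the right argument of the outer product, so `∂` on it becomes `∂ + S`.
-/
theorem outerR_delPoly (hm : IsSesquilinear m) (hS : ∀ x, delPoly₂ k P (S x) = S (delPoly₂ k P x))
    (hT : ∀ x, delPoly₂ k P (T x) = T (delPoly₂ k P x)) (h : ∀ x, T (S x) = S (T x)) (a : P)
    (u : Poly k P) : outerR m S T a (delPoly k P u) =
      delPoly₂ k P (outerR m S T a u) + S (outerR m S T a u) := by
  rw [outerR, subst_delPoly, ← LinearMap.add_apply,
    ← subst_intertwine (T' := T) (fun x => by simp [h, hT])]
  congr 2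
  ext x
  simp [hm.del_right, subst_const₂_delPoly hS, subst_lam]

theorem outerR_del_left (hm : IsSesquilinear m) (h : ∀ x, T (S x) = S (T x)) (a : P)
    (u : Poly k P) : outerR m S T (del k P a) u = -S (outerR m S T a u) := by
  rw [outerR, outerR, ← LinearMap.neg_apply,
    ← subst_intertwine (T' := T) (fun x => by simp [h])]
  congr 2
  ext x
  simp [hm.del_left, subst_lam]

theorem outerL_del_right (hm : IsSesquilinear m')
    (hS : ∀ x, delPoly₂ k P (S x) = S (delPoly₂ k P x))
    (hT : ∀ x, delPoly₂ k P (T x) = T (delPoly₂ k P x)) (h : ∀ x, T (S x) = S (T x)) (c : P)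
    (u : Poly k P) : outerL m' S T (del k P c) u =
      delPoly₂ k P (outerL m' S T c u) + T (outerL m' S T c u) := by
  rw [outerL, outerL, ← LinearMap.add_apply,
    ← subst_intertwine (T' := S) (fun x => by simp [h, hS])]
  congr 2
  ext x
  simp [hm.del_right, subst_const₂_delPoly hT, subst_lam]

theorem subst_const_delPoly {T : Module.End k (Poly k P)}
    (hT : ∀ x, delPoly k P (T x) = T (delPoly k P x)) (u : Poly k P) :
    subst T (const k P) (delPoly k P u) = delPoly k P (subst T (const k P) u) := by
  rw [subst_delPoly, ← subst_intertwine hT]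
  congr 1

theorem oppProd_apply (a b : P) :
    oppProd m a b = subst (-lam k P - delPoly k P) (const k P) (m b a) := by
  simp [oppProd]

/-- Under `λ ↦ -λ - ∂` the factors `-λ` and `∂ + λ` are interchanged, which compensates for the
exchange of the arguments. -/
theorem isSesquilinear_oppProd (hm : IsSesquilinear m) : IsSesquilinear (oppProd m) where
  del_left a b := by
    rw [oppProd_apply, hm.del_right, LinearMap.add_apply, map_add, subst_lam, subst_const_delPoly,
      ← oppProd_apply]
    · simp
    · intro x; simp [delPoly_lam]
  del_right a b := by
    rw [oppProd_apply, hm.del_left, map_neg, subst_lam, ← oppProd_apply]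
    simp

end Nested

/-! ### Commutativity and skew-symmetry of the products on `k[∂] ⊗ A`. -/

section Axioms

variable {k : Type*} [Field k] {A : Type*} [AddCommGroup A] [Module k A]

theorem corrBracket_incl (circ br : A →ₗ[k] A →ₗ[k] A) (a b : A) :
    corrBracket circ br (incl k A a) (incl k A b) =
      delPoly k _ (const k _ (incl k A (circ b a))) +
        lam k _ (const k _ (incl k A (circ b a + circ a b))) + const k _ (incl k A (br a b)) := by
  rw [corrBracket, sesqExt_incl, delPoly_const]
  simp [star]

theorem corrProd_incl (dot : A →ₗ[k] A →ₗ[k] A) (a b : A) :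
    corrProd dot (incl k A a) (incl k A b) = const k _ (incl k A (dot a b)) := by
  rw [corrProd, sesqExt_incl]
  simp

theorem isSesquilinear_corrBracket (circ br : A →ₗ[k] A →ₗ[k] A) :
    IsSesquilinear (corrBracket circ br) := isSesquilinear_sesqExt _

theorem isSesquilinear_corrProd (dot : A →ₗ[k] A →ₗ[k] A) :
    IsSesquilinear (corrProd dot) := isSesquilinear_sesqExt _

theorem lamProd_ext {m m' : LamProd k (Free k A)} (hm : IsSesquilinear m) (hm' : IsSesquilinear m')
    (h : ∀ a b, m (incl k A a) (incl k A b) = m' (incl k A a) (incl k A b)) (a b : Free k A) :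
    m a b = m' a b := by
  refine sub_eq_zero.1 (free_induction₂ (F := fun a b => m a b - m' a b)
    (S := -lam k _) (T := delPoly k _ + lam k _) ?_ ?_ ?_ ?_ ?_ a b)
  · intro a b; simp [h]
  · intros; simp; abel
  · intros; simp; abel
  · intros; simp [hm.del_left, hm'.del_left]; abel
  · intros; simp [hm.del_right, hm'.del_right]; abel

theorem corrProd_comm {dot : A →ₗ[k] A →ₗ[k] A} (h : ∀ a b, dot a b = dot b a)
    (a b : Free k A) : corrProd dot a b = oppProd (corrProd dot) a b := by
  refine lamProd_ext (isSesquilinear_corrProd _)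
    (isSesquilinear_oppProd (isSesquilinear_corrProd _)) (fun a b => ?_) a b
  rw [oppProd_apply, corrProd_incl, corrProd_incl, subst_const, h]

/-- The Novikov part needs no hypothesis: substituting `-λ - ∂` in `∂(a ∘ b) + λ(a ⋆ b)` gives `∂(a
∘ b) - (λ + ∂)(a ⋆ b) = -∂(b ∘ a) - λ(b ⋆ a)`. -/
theorem corrBracket_skew (circ : A →ₗ[k] A →ₗ[k] A) {br : A →ₗ[k] A →ₗ[k] A}
    (h : ∀ a b, br a b = -br b a) (a b : Free k A) :
    corrBracket circ br a b = -oppProd (corrBracket circ br) a b := by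
  have hs := isSesquilinear_corrBracket circ br
  have ho := isSesquilinear_oppProd hs
  refine eq_neg_of_add_eq_zero_left (free_induction₂
    (F := fun a b => corrBracket circ br a b + oppProd (corrBracket circ br) a b)
    (S := -lam k _) (T := delPoly k _ + lam k _) ?_ ?_ ?_ ?_ ?_ a b)
  · intro a b
    rw [oppProd_apply, corrBracket_incl, corrBracket_incl, h b a]
    have hc : ∀ x, delPoly k (Free k A) ((-lam k (Free k A) - delPoly k (Free k A)) x) =
        (-lam k (Free k A) - delPoly k (Free k A)) (delPoly k _ x) := fun x => by simp [delPoly_lam]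
    simp [subst_lam, subst_const_delPoly hc]
    abel
  · intros; simp; abel
  · intros; simp; abel
  · intros; simp [hs.del_left, ho.del_left]; abel
  · intros; simp [hs.del_right, ho.del_right]; abel

end Axioms

/-! ### The dependence of nested products on `∂` in each argument. -/

section Nested

variable {k : Type*} [Field k] {P : Type*} [AddCommGroup P] [Module k P] [Module k[X] P]
  [IsScalarTower k k[X] P]

/-- The operators for the three arguments are `-λ`, `-μ` and `∂ + λ + μ`. The second arises as `-(λ
+ μ) + λ`: the inner product yields `∂ + λ`, and its `∂` becomes `-(λ + μ)` in the outer one. -/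
theorem nestL_sesquilinear {m m' : LamProd k P} (hm : IsSesquilinear m) (hm' : IsSesquilinear m') :
    (∀ a a' b c, nestL m m' (lam₂ k P) (lam₂ k P + mu₂ k P) (a + a') b c =
      nestL m m' (lam₂ k P) (lam₂ k P + mu₂ k P) a b c +
        nestL m m' (lam₂ k P) (lam₂ k P + mu₂ k P) a' b c) ∧
    (∀ a b b' c, nestL m m' (lam₂ k P) (lam₂ k P + mu₂ k P) a (b + b') c =
      nestL m m' (lam₂ k P) (lam₂ k P + mu₂ k P) a b c +
        nestL m m' (lam₂ k P) (lam₂ k P + mu₂ k P) a b' c) ∧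
    (∀ a b c c', nestL m m' (lam₂ k P) (lam₂ k P + mu₂ k P) a b (c + c') =
      nestL m m' (lam₂ k P) (lam₂ k P + mu₂ k P) a b c +
        nestL m m' (lam₂ k P) (lam₂ k P + mu₂ k P) a b c') ∧
    (∀ a b c, nestL m m' (lam₂ k P) (lam₂ k P + mu₂ k P) (del k P a) b c =
      -lam₂ k P (nestL m m' (lam₂ k P) (lam₂ k P + mu₂ k P) a b c)) ∧
    (∀ a b c, nestL m m' (lam₂ k P) (lam₂ k P + mu₂ k P) a (del k P b) c =
      -mu₂ k P (nestL m m' (lam₂ k P) (lam₂ k P + mu₂ k P) a b c)) ∧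
    (∀ a b c, nestL m m' (lam₂ k P) (lam₂ k P + mu₂ k P) a b (del k P c) =
      delPoly₂ k P (nestL m m' (lam₂ k P) (lam₂ k P + mu₂ k P) a b c) +
      lam₂ k P (nestL m m' (lam₂ k P) (lam₂ k P + mu₂ k P) a b c) +
      mu₂ k P (nestL m m' (lam₂ k P) (lam₂ k P + mu₂ k P) a b c)) := by
  have h : ∀ x, (lam₂ k P + mu₂ k P) (lam₂ k P x) = lam₂ k P ((lam₂ k P + mu₂ k P) x) := by
    simp [mu₂_lam₂]
  have hT : ∀ x, delPoly₂ k P ((lam₂ k P + mu₂ k P) x) =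
      (lam₂ k P + mu₂ k P) (delPoly₂ k P x) := by
    simp [delPoly₂_lam₂, delPoly₂_mu₂]
  simp only [nestL_eq]
  refine ⟨fun a a' b c => ?_, fun a b b' c => ?_, fun a b c c' => ?_, fun a b c => ?_,
    fun a b c => ?_, fun a b c => ?_⟩
  · simp
  · simp
  · rw [outerL_add_right]
  · rw [hm.del_left, map_neg, outerL_lam]
  · rw [hm.del_right, LinearMap.add_apply, map_add, outerL_lam, outerL_delPoly hm' h]
    simp
  · rw [outerL_del_right hm' delPoly₂_lam₂ hT h]
    simp [add_assoc]

/-- The operators `S`, `T` are kept general because the Jacobi and Leibniz identities also contain a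
term with `λ` and `μ` exchanged. -/
theorem nestR_sesquilinear {m m' : LamProd k P} (hm : IsSesquilinear m) (hm' : IsSesquilinear m')
    {S T : Module.End k (Poly₂ k P)} (hS : ∀ x, delPoly₂ k P (S x) = S (delPoly₂ k P x))
    (hT : ∀ x, delPoly₂ k P (T x) = T (delPoly₂ k P x)) (h : ∀ x, T (S x) = S (T x)) :
    (∀ a a' b c, nestR m m' S T (a + a') b c = nestR m m' S T a b c + nestR m m' S T a' b c) ∧
    (∀ a b b' c, nestR m m' S T a (b + b') c = nestR m m' S T a b c + nestR m m' S T a b' c) ∧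
    (∀ a b c c', nestR m m' S T a b (c + c') = nestR m m' S T a b c + nestR m m' S T a b c') ∧
    (∀ a b c, nestR m m' S T (del k P a) b c = -S (nestR m m' S T a b c)) ∧
    (∀ a b c, nestR m m' S T a (del k P b) c = -T (nestR m m' S T a b c)) ∧
    (∀ a b c, nestR m m' S T a b (del k P c) =
      delPoly₂ k P (nestR m m' S T a b c) + S (nestR m m' S T a b c) +
        T (nestR m m' S T a b c)) := by
  simp only [nestR_eq]
  refine ⟨fun a a' b c => ?_, fun a b b' c => ?_, fun a b c c' => ?_, fun a b c => ?_,
    fun a b c => ?_, fun a b c => ?_⟩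
  · rw [outerR_add_left]
  · simp
  · simp
  · rw [outerR_del_left hm h]
  · rw [hm'.del_left, map_neg, outerR_lam]
  · rw [hm'.del_right, LinearMap.add_apply, map_add, outerR_lam, outerR_delPoly hm hS hT h]

end Nested

/-! ### From PGD-algebras to Poisson conformal algebras. -/

section Axioms

variable {k : Type*} [Field k] {A : Type*} [AddCommGroup A] [Module k A]

/-- All three terms carry the same operators `-λ`, `-μ`, `∂ + λ + μ` for `a`, `b`, `c`, since the
last one exchanges both the arguments and the variables. The six products are independent so that
Jacobi and Leibniz are both instances, and associativity too, with zero in the last term. -/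
theorem nest_ext {m₁ m₂ m₃ m₄ m₅ m₆ : LamProd k (Free k A)} (h₁ : IsSesquilinear m₁)
    (h₂ : IsSesquilinear m₂) (h₃ : IsSesquilinear m₃) (h₄ : IsSesquilinear m₄)
    (h₅ : IsSesquilinear m₅) (h₆ : IsSesquilinear m₆)
    (h : ∀ a b c : A,
      nestR m₁ m₂ (lam₂ k _) (mu₂ k _) (incl k A a) (incl k A b) (incl k A c) =
        nestL m₃ m₄ (lam₂ k _) (lam₂ k _ + mu₂ k _) (incl k A a) (incl k A b) (incl k A c) +
          nestR m₅ m₆ (mu₂ k _) (lam₂ k _) (incl k A b) (incl k A a) (incl k A c))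
    (a b c : Free k A) :
    nestR m₁ m₂ (lam₂ k _) (mu₂ k _) a b c =
      nestL m₃ m₄ (lam₂ k _) (lam₂ k _ + mu₂ k _) a b c +
        nestR m₅ m₆ (mu₂ k _) (lam₂ k _) b a c := by
  obtain ⟨x1, x2, x3, x4, x5, x6⟩ := nestR_sesquilinear h₁ h₂ (k := k) (S := lam₂ k _)
    (T := mu₂ k _) delPoly₂_lam₂ delPoly₂_mu₂ mu₂_lam₂
  obtain ⟨z1, z2, z3, z4, z5, z6⟩ := nestR_sesquilinear h₅ h₆ (k := k) (S := mu₂ k _)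
    (T := lam₂ k _) delPoly₂_mu₂ delPoly₂_lam₂ (fun x => (mu₂_lam₂ x).symm)
  obtain ⟨y1, y2, y3, y4, y5, y6⟩ := nestL_sesquilinear h₃ h₄
  refine sub_eq_zero.1 (free_induction₃ (F := fun a b c =>
    nestR m₁ m₂ (lam₂ k _) (mu₂ k _) a b c - (nestL m₃ m₄ (lam₂ k _) (lam₂ k _ + mu₂ k _) a b c +
        nestR m₅ m₆ (mu₂ k _) (lam₂ k _) b a c))
    (R := -lam₂ k _) (S := -mu₂ k _) (T := delPoly₂ k _ + lam₂ k _ + mu₂ k _)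
    ?_ ?_ ?_ ?_ ?_ ?_ ?_ a b c)
  · intro a b c; rw [h, sub_self]
  · intros; simp only [x1, y1, z2]; abel
  · intros; simp only [x2, y2, z1]; abel
  · intros; simp only [x3, y3, z3]; abel
  · intros; simp only [x4, y4, z5, map_sub, map_add, LinearMap.neg_apply]
  · intros; simp only [x5, y5, z4, map_sub, map_add, LinearMap.neg_apply]
  · intros; simp only [x6, y6, z6, map_sub, map_add, LinearMap.add_apply]; abel

theorem nest_ext' {m₁ m₂ m₃ m₄ : LamProd k (Free k A)} (h₁ : IsSesquilinear m₁)
    (h₂ : IsSesquilinear m₂) (h₃ : IsSesquilinear m₃) (h₄ : IsSesquilinear m₄)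
    (h : ∀ a b c : A,
      nestL m₃ m₄ (lam₂ k _) (lam₂ k _ + mu₂ k _) (incl k A a) (incl k A b) (incl k A c) =
        nestR m₁ m₂ (lam₂ k _) (mu₂ k _) (incl k A a) (incl k A b) (incl k A c))
    (a b c : Free k A) :
    nestL m₃ m₄ (lam₂ k _) (lam₂ k _ + mu₂ k _) a b c =
      nestR m₁ m₂ (lam₂ k _) (mu₂ k _) a b c := by
  have h0 : IsSesquilinear (0 : LamProd k (Free k A)) := ⟨by simp, by simp⟩
  have := nest_ext h₁ h₂ h₃ h₄ h0 h0 (fun a b c => by rw [h]; simp [nestR]) a b c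
  rw [this]; simp [nestR]

theorem IsLieAlg.skew {br : A →ₗ[k] A →ₗ[k] A} (h : IsLieAlg br) (a b : A) :
    br a b = -br b a := by
  have := h.self (a + b)
  simp only [map_add, LinearMap.add_apply, h.self, zero_add, add_zero] at this
  exact eq_neg_of_add_eq_zero_right this

/-- On `A` each identity is a polynomial in `∂`, `λ`, `μ`. For Jacobi, the Novikov axioms settle
degree two, the Gel'fand-Dorfman identity with skewness settles degree one, and the Jacobi identity
of `A` settles degree zero. -/
theorem isPoissonConformalAlgebra_corr {circ dot br : A →ₗ[k] A →ₗ[k] A}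
    (hA : IsPGDAlgebra circ dot br) :
    IsPoissonConformalAlgebra (corrBracket circ br) (corrProd dot) := by
  have hb := isSesquilinear_corrBracket circ br
  have hm := isSesquilinear_corrProd dot
  have sk := hA.gd.lie.skew
  have hJ := hA.gd.lie.jacobi
  have rc := hA.gd.novikov.right_comm
  have ls := hA.gd.novikov.left_symm
  have gd := hA.gd.compat
  have cm := hA.poisson.commAssoc.comm
  have asc := hA.poisson.commAssoc.assoc
  have lz := hA.poisson.leibniz
  have c1 := hA.dnp.compat₁
  have c2 := hA.dnp.compat₂
  have gd' : ∀ a b c, -br b (circ c a) + br a (circ c b) - circ (br a c) b + circ (br b c) a -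
      circ c (br a b) = 0 := fun a b c => by
    have := gd c a b
    rw [sk (circ c a) b, sk (circ c b) a, sk c a, sk c b] at this
    simpa [sub_eq_add_neg] using this
  have c3 : ∀ a b c, dot (circ b a) c = dot b (circ c a) := fun a b c => by
    rw [cm, ← c1, cm c b, c1]
  let D := delPoly₂ k (Free k A)
  let L := lam₂ k (Free k A)
  let M := mu₂ k (Free k A)
  have K : ∀ (f : Module.End k (Poly₂ k (Free k A))) {x y : A}, x = y →
      f (const₂ k _ (incl k A x)) = f (const₂ k _ (incl k A y)) := fun f x y h => by rw [h]
  have hL := delPoly₂_lam₂ (k := k) (P := Free k A)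
  have hM := delPoly₂_mu₂ (k := k) (P := Free k A)
  have hML := mu₂_lam₂ (k := k) (P := Free k A)
  have hLM := fun x => (hML x).symm
  have hLT : ∀ x, (lam₂ k (Free k A) + mu₂ k (Free k A)) (lam₂ k _ x) =
      lam₂ k _ ((lam₂ k (Free k A) + mu₂ k (Free k A)) x) := by
    simp [mu₂_lam₂]
  have hT : ∀ x, delPoly₂ k (Free k A) ((lam₂ k (Free k A) + mu₂ k (Free k A)) x) =
      (lam₂ k (Free k A) + mu₂ k (Free k A)) (delPoly₂ k (Free k A) x) := by
    simp [delPoly₂_lam₂, delPoly₂_mu₂]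
  refine ⟨⟨hb, corrBracket_skew circ sk, nest_ext hb hb hb hb hb hb fun a b c => ?_⟩,
    ⟨⟨hm, nest_ext' hm hm hm hm fun a b c => ?_⟩, corrProd_comm cm⟩,
    nest_ext hb hm hb hm hm hb fun a b c => ?_⟩
  · simp only [nestR_eq, nestL_eq, corrBracket_incl, map_add, outerR_lam, outerR_const,
      outerL_lam, outerL_const, outerL_delPoly hb hLT, outerR_delPoly hb hL hM hML,
      outerR_delPoly hb hM hL hLM, subst_lam, subst_const, subst_const₂_delPoly hL,
      subst_const₂_delPoly hM, subst_const₂_delPoly hT, LinearMap.add_apply]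
    linear_combination (norm := (simp only [D, L, M, map_add, map_sub, map_neg, map_zero,
        hL, hM, hML, Module.End.mul_apply, Module.End.one_apply, LinearMap.neg_apply]; module))
      -- Each summand is an identity of `A` placed at the monomial to whose coefficient it
      -- contributes.
      K (D * D) (rc c b a) + (2 : k) • K (L * D) (rc c b a) + K (L * D) (ls c a b) +
      (2 : k) • K (M * D) (rc c b a) - K (M * D) (ls c b a) + K (L * L) (rc c b a) +
      K (L * L) (ls c a b) + K (L * L) (rc a c b) + K (M * M) (rc c b a) - K (M * M) (ls c b a) -
      K (M * M) (rc b c a) + (2 : k) • K (L * M) (rc c b a) + K (L * M) (ls c a b) -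
      K (L * M) (ls c b a) - K (L * M) (ls a b c) + K D (gd' a b c) + K L (gd' a b c) -
      K L (gd a b c) - K L (sk (circ a c) b) + K M (gd' a b c) + K M (gd b a c) +
      K M (sk (circ b c) a) - K M (congrArg (fun x => circ x c) (sk b a)) + K 1 (hJ a b c)
  · simp only [nestR_eq, nestL_eq, corrProd_incl, outerR_const, outerL_const, subst_const, asc]
  · simp only [nestR_eq, nestL_eq, corrBracket_incl, corrProd_incl, map_add, outerR_lam,
      outerR_const, outerL_lam, outerL_const, outerL_delPoly hm hLT, outerR_delPoly hm hM hL hLM,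
      subst_lam, subst_const, subst_const₂_delPoly hL, LinearMap.add_apply]
    linear_combination (norm := (simp only [map_add, Module.End.one_apply]; module))
      K D (c1 b c a) + K L (c1 b c a) + K L (c2 a b c) + K M (c3 a b c) + K 1 (lz a b c)

end Axioms

/-! ### Comparison of coefficients for quadratic polynomials in three operators. -/

section Quadratic

variable {k : Type*} [Field k] {W V : Type*} [AddCommGroup W] [Module k W] [AddCommGroup V]
  [Module k V]

/-- The quadratic polynomial in the operators `X, Y, Z` with coefficients in the image of `K`. -/
def quad (X Y Z : Module.End k V) (K : W →ₗ[k] V)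
    (t x y z xx xy xz yy yz zz : W) : V :=
  K t + X (K x) + Y (K y) + Z (K z) + X (X (K xx)) + X (Y (K xy)) + X (Z (K xz)) + Y (Y (K yy)) +
    Y (Z (K yz)) + Z (Z (K zz))

/-- A family of coefficient maps for polynomials in the operators `X, Y, Z`. -/
structure IsCoeff (X Y Z : Module.End k V) (K : W →ₗ[k] V) (c : ℕ → ℕ → ℕ → V →ₗ[k] W) : Prop where
  base : ∀ t, c 0 0 0 (K t) = t
  base₁ : ∀ i j l t, c (i + 1) j l (K t) = 0
  base₂ : ∀ i j l t, c i (j + 1) l (K t) = 0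
  base₃ : ∀ i j l t, c i j (l + 1) (K t) = 0
  zero₁ : ∀ j l v, c 0 j l (X v) = 0
  zero₂ : ∀ i l v, c i 0 l (Y v) = 0
  zero₃ : ∀ i j v, c i j 0 (Z v) = 0
  succ₁ : ∀ i j l v, c (i + 1) j l (X v) = c i j l v
  succ₂ : ∀ i j l v, c i (j + 1) l (Y v) = c i j l v
  succ₃ : ∀ i j l v, c i j (l + 1) (Z v) = c i j l v

/-- Applying the coefficient map of a monomial lowers exponents along that monomial and kills every
other term. The setting is abstract because it serves both `P ⊗ P ⊗ P` and `(P ⊗ P)[λ]`. -/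
theorem IsCoeff.quad_eq_zero_iff {X Y Z : Module.End k V} {K : W →ₗ[k] V}
    {c : ℕ → ℕ → ℕ → V →ₗ[k] W} (h : IsCoeff X Y Z K c) {t x y z xx xy xz yy yz zz : W} :
    quad X Y Z K t x y z xx xy xz yy yz zz = 0 ↔ t = 0 ∧ x = 0 ∧ y = 0 ∧ z = 0 ∧ xx = 0 ∧
      xy = 0 ∧ xz = 0 ∧ yy = 0 ∧ yz = 0 ∧ zz = 0 := by
  refine ⟨fun H => ?_, ?_⟩
  · have H' : ∀ i j l, c i j l (quad X Y Z K t x y z xx xy xz yy yz zz) = 0 := by simp [H]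
    -- The rules are specialised to the exponents 1 and 2 in literal form, so that they match the
    -- indices in `H'`.
    have s₁ := h.succ₁ 0
    have s₂ := fun i => h.succ₂ i 0
    have s₃ := fun i j => h.succ₃ i j 0
    have t₁ := h.succ₁ 1
    have t₂ := fun i => h.succ₂ i 1
    have t₃ := fun i j => h.succ₃ i j 1
    have b₁ := h.base₁ 0
    have b₂ := fun i => h.base₂ i 0
    have b₃ := fun i j => h.base₃ i j 0
    have d₁ := h.base₁ 1
    have d₂ := fun i => h.base₂ i 1
    have d₃ := fun i j => h.base₃ i j 1
    simp only [zero_add, Nat.reduceAdd] at s₁ s₂ s₃ t₁ t₂ t₃ b₁ b₂ b₃ d₁ d₂ d₃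
    simp only [quad, map_add] at H'
    refine ⟨?_, ?_, ?_, ?_, ?_, ?_, ?_, ?_, ?_, ?_⟩
    · simpa only [h.base, h.zero₁, h.zero₂, h.zero₃, add_zero] using H' 0 0 0
    · simpa only [h.base, h.zero₁, h.zero₂, h.zero₃, s₁, b₁, add_zero, zero_add] using H' 1 0 0
    · simpa only [h.base, h.zero₁, h.zero₂, h.zero₃, s₂, b₂, add_zero, zero_add] using H' 0 1 0
    · simpa only [h.base, h.zero₁, h.zero₂, h.zero₃, s₃, b₃, add_zero, zero_add] using H' 0 0 1
    · simpa only [h.base, h.zero₁, h.zero₂, h.zero₃, s₁, b₁, t₁, d₁, add_zero, zero_add]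
        using H' 2 0 0
    · simpa only [h.base, h.zero₁, h.zero₂, h.zero₃, s₁, b₁, s₂, b₂, add_zero, zero_add]
        using H' 1 1 0
    · simpa only [h.base, h.zero₁, h.zero₂, h.zero₃, s₁, b₁, s₃, b₃, add_zero, zero_add]
        using H' 1 0 1
    · simpa only [h.base, h.zero₁, h.zero₂, h.zero₃, s₂, b₂, t₂, d₂, add_zero, zero_add]
        using H' 0 2 0
    · simpa only [h.base, h.zero₁, h.zero₂, h.zero₃, s₂, b₂, s₃, b₃, add_zero, zero_add]
        using H' 0 1 1
    · simpa only [h.base, h.zero₁, h.zero₂, h.zero₃, s₃, b₃, t₃, d₃, add_zero, zero_add]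
        using H' 0 0 2
  · rintro ⟨rfl, rfl, rfl, rfl, rfl, rfl, rfl, rfl, rfl, rfl⟩
    simp [quad]

end Quadratic

/-! ### Coefficients of powers of `∂` in `k[∂] ⊗ A`. -/

section Coeff

variable (k : Type*) [Field k] (A : Type*) [AddCommGroup A] [Module k A]

/-- The coefficient of `∂ ^ n` in `k[∂] ⊗ A`. -/
def freeCoeff (n : ℕ) : Free k A →ₗ[k] A :=
  freeLift ((LinearMap.lsmul k A) ∘ₗ Polynomial.lcoeff k n)

variable {k A}

theorem freeCoeff_incl_zero (a : A) : freeCoeff k A 0 (incl k A a) = a := by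
  simp [freeCoeff, incl]

theorem freeCoeff_incl_succ (n : ℕ) (a : A) : freeCoeff k A (n + 1) (incl k A a) = 0 := by
  simp [freeCoeff, incl, Polynomial.coeff_one]

theorem freeCoeff_del_zero (p : Free k A) : freeCoeff k A 0 (del k _ p) = 0 := by
  induction p using freeMk_induction with
  | hadd x y hx hy => simp [hx, hy]
  | hmk f a => simp [freeCoeff, ← freeMk_X_mul]

theorem freeCoeff_del_succ (n : ℕ) (p : Free k A) :
    freeCoeff k A (n + 1) (del k _ p) = freeCoeff k A n p := by
  induction p using freeMk_induction with
  | hadd x y hx hy => simp [hx, hy]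
  | hmk f a => simp [freeCoeff, ← freeMk_X_mul]

end Coeff

/-! ### The symmetric group on `V ⊗ V ⊗ V` and coproducts. -/

section Tensor

variable {k : Type*} [Field k] {V : Type*} [AddCommGroup V] [Module k V]

/-- `I ⊗ τ` on `V ⊗ V ⊗ V`. -/
def flip₂₃ : V ⊗[k] (V ⊗[k] V) →ₗ[k] V ⊗[k] (V ⊗[k] V) := (flip₂ (k := k) (V := V)).lTensor V

theorem tensor₃_ext {N : Type*} [AddCommGroup N] [Module k N] {f g : V ⊗[k] (V ⊗[k] V) →ₗ[k] N}
    (h : ∀ x y z, f (x ⊗ₜ (y ⊗ₜ z)) = g (x ⊗ₜ (y ⊗ₜ z))) (t : V ⊗[k] (V ⊗[k] V)) : f t = g t := by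
  refine LinearMap.congr_fun (f := f) (g := g) ?_ t
  ext x y z
  exact h x y z

theorem tensor₂_ext {N : Type*} [AddCommGroup N] [Module k N] {f g : V ⊗[k] V →ₗ[k] N}
    (h : ∀ x y, f (x ⊗ₜ y) = g (x ⊗ₜ y)) (t : V ⊗[k] V) : f t = g t :=
  LinearMap.congr_fun (TensorProduct.ext' h) t

theorem flip₂_flip₂ (t : V ⊗[k] V) : flip₂ (flip₂ t) = t := by simp

theorem flip₁₂_flip₁₂ (t : V ⊗[k] (V ⊗[k] V)) : flip₁₂ (flip₁₂ t) = t :=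
  tensor₃_ext (f := flip₁₂ ∘ₗ flip₁₂) (g := LinearMap.id) (fun x y z => by simp) t

theorem flip₂₃_flip₂₃ (t : V ⊗[k] (V ⊗[k] V)) : flip₂₃ (flip₂₃ t) = t :=
  tensor₃_ext (f := flip₂₃ ∘ₗ flip₂₃) (g := LinearMap.id) (fun x y z => by simp [flip₂₃]) t

theorem flip_braid (t : V ⊗[k] (V ⊗[k] V)) :
    flip₂₃ (flip₁₂ (flip₂₃ t)) = flip₁₂ (flip₂₃ (flip₁₂ t)) :=
  tensor₃_ext (f := flip₂₃ ∘ₗ flip₁₂ ∘ₗ flip₂₃) (g := flip₁₂ ∘ₗ flip₂₃ ∘ₗ flip₁₂)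
    (fun x y z => by simp [flip₂₃]) t

/-- This eliminates `coL`: all coalgebra identities become relations among permuted values of `coR`,
to be compared by means of the two transpositions and the braid relation. -/
theorem coL_eq (Δ : V →ₗ[k] V ⊗[k] V) (t : V ⊗[k] V) :
    coL Δ t = flip₂₃ (flip₁₂ (coR Δ (flip₂ t))) := by
  refine tensor₂_ext (f := coL Δ) (g := flip₂₃ ∘ₗ flip₁₂ ∘ₗ coR Δ ∘ₗ flip₂) (fun x y => ?_) t
  simp only [coL, coR, LinearMap.comp_apply, LinearMap.rTensor_tmul, flip₂,
    LinearEquiv.coe_coe, TensorProduct.comm_tmul, LinearMap.lTensor_tmul]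
  exact tensor₂_ext (f := (TensorProduct.assoc k V V V).toLinearMap ∘ₗ
    (TensorProduct.mk k (V ⊗[k] V) V).flip y)
    (g := flip₂₃ ∘ₗ flip₁₂ ∘ₗ TensorProduct.mk k V (V ⊗[k] V) y) (fun u v => by simp [flip₂₃]) (Δ x)

theorem flip₂₃_coR (Δ : V →ₗ[k] V ⊗[k] V) (t : V ⊗[k] V) :
    flip₂₃ (coR Δ t) = coR (flip₂ ∘ₗ Δ) t := by
  rw [coR, coR, flip₂₃, ← LinearMap.comp_apply, ← LinearMap.lTensor_comp]

theorem flip₂₃_coR_of_skew {Δ : V →ₗ[k] V ⊗[k] V} (h : ∀ a, Δ a = -flip₂ (Δ a)) (t : V ⊗[k] V) :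
    flip₂₃ (coR Δ t) = -coR Δ t := by
  have : flip₂ ∘ₗ Δ = -Δ := LinearMap.ext fun a => by
    rw [LinearMap.neg_apply, LinearMap.comp_apply]; nth_rw 2 [h]; simp
  rw [flip₂₃_coR, this, coR, LinearMap.lTensor_neg]; rfl

theorem flip₂₃_coR_of_symm {Δ : V →ₗ[k] V ⊗[k] V} (h : ∀ a, Δ a = flip₂ (Δ a)) (t : V ⊗[k] V) :
    flip₂₃ (coR Δ t) = coR Δ t := by
  rw [flip₂₃_coR, show flip₂ ∘ₗ Δ = Δ from LinearMap.ext fun a => (h a).symm]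

end Tensor

/-! ### The operator `∂` on the factors of tensor powers. -/

section Conformal

variable (k : Type*) [Field k] (P : Type*) [AddCommGroup P] [Module k P] [Module k[X] P]
  [IsScalarTower k k[X] P]

/-- `∂ ⊗ I` on `P ⊗ P`. -/
def delL : Module.End k (P ⊗[k] P) := (del k P).rTensor P

/-- `I ⊗ ∂` on `P ⊗ P`. -/
def delR : Module.End k (P ⊗[k] P) := (del k P).lTensor P

/-- `∂ ⊗ I ⊗ I` on `P ⊗ P ⊗ P`. -/
def del₁₃ : Module.End k (P ⊗[k] (P ⊗[k] P)) := (del k P).rTensor (P ⊗[k] P)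

/-- `I ⊗ ∂ ⊗ I` on `P ⊗ P ⊗ P`. -/
def del₂₃ : Module.End k (P ⊗[k] (P ⊗[k] P)) := (delL k P).lTensor P

/-- `I ⊗ I ⊗ ∂` on `P ⊗ P ⊗ P`. -/
def del₃₃ : Module.End k (P ⊗[k] (P ⊗[k] P)) := (delR k P).lTensor P

variable {k P}

theorem del₂_apply (u : P ⊗[k] P) : del₂ k P u = delL k P u + delR k P u := rfl

theorem delR_delL (u : P ⊗[k] P) : delR k P (delL k P u) = delL k P (delR k P u) :=
  tensor₂_ext (f := delR k P ∘ₗ delL k P) (g := delL k P ∘ₗ delR k P)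
    (fun x y => by simp [delL, delR]) u

theorem flip₂_delL (u : P ⊗[k] P) : flip₂ (delL k P u) = delR k P (flip₂ u) :=
  tensor₂_ext (f := flip₂ ∘ₗ delL k P) (g := delR k P ∘ₗ flip₂) (fun x y => by simp [delL, delR]) u

theorem flip₂_delR (u : P ⊗[k] P) : flip₂ (delR k P u) = delL k P (flip₂ u) :=
  tensor₂_ext (f := flip₂ ∘ₗ delR k P) (g := delL k P ∘ₗ flip₂) (fun x y => by simp [delL, delR]) u

theorem del₂₃_del₁₃ (u : P ⊗[k] (P ⊗[k] P)) : del₂₃ k P (del₁₃ k P u) = del₁₃ k P (del₂₃ k P u) :=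
  tensor₃_ext (f := del₂₃ k P ∘ₗ del₁₃ k P) (g := del₁₃ k P ∘ₗ del₂₃ k P)
    (fun x y z => by simp [del₁₃, del₂₃]) u

theorem del₃₃_del₁₃ (u : P ⊗[k] (P ⊗[k] P)) : del₃₃ k P (del₁₃ k P u) = del₁₃ k P (del₃₃ k P u) :=
  tensor₃_ext (f := del₃₃ k P ∘ₗ del₁₃ k P) (g := del₁₃ k P ∘ₗ del₃₃ k P)
    (fun x y z => by simp [del₁₃, del₃₃]) u

theorem del₃₃_del₂₃ (u : P ⊗[k] (P ⊗[k] P)) : del₃₃ k P (del₂₃ k P u) = del₂₃ k P (del₃₃ k P u) :=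
  tensor₃_ext (f := del₃₃ k P ∘ₗ del₂₃ k P) (g := del₂₃ k P ∘ₗ del₃₃ k P)
    (fun x y z => by simp [del₂₃, del₃₃, delR_delL]) u

theorem flip₁₂_del₁₃ (u : P ⊗[k] (P ⊗[k] P)) : flip₁₂ (del₁₃ k P u) = del₂₃ k P (flip₁₂ u) :=
  tensor₃_ext (f := flip₁₂ ∘ₗ del₁₃ k P) (g := del₂₃ k P ∘ₗ flip₁₂)
    (fun x y z => by simp [del₁₃, del₂₃, delL]) u

theorem flip₁₂_del₂₃ (u : P ⊗[k] (P ⊗[k] P)) : flip₁₂ (del₂₃ k P u) = del₁₃ k P (flip₁₂ u) :=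
  tensor₃_ext (f := flip₁₂ ∘ₗ del₂₃ k P) (g := del₁₃ k P ∘ₗ flip₁₂)
    (fun x y z => by simp [del₁₃, del₂₃, delL]) u

theorem flip₁₂_del₃₃ (u : P ⊗[k] (P ⊗[k] P)) : flip₁₂ (del₃₃ k P u) = del₃₃ k P (flip₁₂ u) :=
  tensor₃_ext (f := flip₁₂ ∘ₗ del₃₃ k P) (g := del₃₃ k P ∘ₗ flip₁₂)
    (fun x y z => by simp [del₃₃, delR]) u

theorem flip₂₃_del₁₃ (u : P ⊗[k] (P ⊗[k] P)) : flip₂₃ (del₁₃ k P u) = del₁₃ k P (flip₂₃ u) :=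
  tensor₃_ext (f := flip₂₃ ∘ₗ del₁₃ k P) (g := del₁₃ k P ∘ₗ flip₂₃)
    (fun x y z => by simp [del₁₃, flip₂₃]) u

theorem flip₂₃_del₂₃ (u : P ⊗[k] (P ⊗[k] P)) : flip₂₃ (del₂₃ k P u) = del₃₃ k P (flip₂₃ u) :=
  tensor₃_ext (f := flip₂₃ ∘ₗ del₂₃ k P) (g := del₃₃ k P ∘ₗ flip₂₃)
    (fun x y z => by simp [del₂₃, del₃₃, flip₂₃, delL, delR]) u

theorem flip₂₃_del₃₃ (u : P ⊗[k] (P ⊗[k] P)) : flip₂₃ (del₃₃ k P u) = del₂₃ k P (flip₂₃ u) :=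
  tensor₃_ext (f := flip₂₃ ∘ₗ del₃₃ k P) (g := del₂₃ k P ∘ₗ flip₂₃)
    (fun x y z => by simp [del₂₃, del₃₃, flip₂₃, delL, delR]) u

theorem coR_delL (Δ : P →ₗ[k] P ⊗[k] P) (u : P ⊗[k] P) :
    coR Δ (delL k P u) = del₁₃ k P (coR Δ u) :=
  tensor₂_ext (f := coR Δ ∘ₗ delL k P) (g := del₁₃ k P ∘ₗ coR Δ)
    (fun x y => by simp [coR, delL, del₁₃]) u

theorem coR_delR {Δ : P →ₗ[k] P ⊗[k] P} (h : IsDelHom Δ) (u : P ⊗[k] P) :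
    coR Δ (delR k P u) = del₂₃ k P (coR Δ u) + del₃₃ k P (coR Δ u) :=
  tensor₂_ext (f := coR Δ ∘ₗ delR k P) (g := del₂₃ k P ∘ₗ coR Δ + del₃₃ k P ∘ₗ coR Δ)
    (fun x y => by simp [coR, delR, del₂₃, del₃₃, h y, del₂_apply, TensorProduct.tmul_add]) u

theorem coL_delL {Δ : P →ₗ[k] P ⊗[k] P} (h : IsDelHom Δ) (u : P ⊗[k] P) :
    coL Δ (delL k P u) = del₁₃ k P (coL Δ u) + del₂₃ k P (coL Δ u) := by
  simp only [coL_eq, flip₂_delL, coR_delR h, map_add, flip₁₂_del₂₃, flip₁₂_del₃₃, flip₂₃_del₁₃,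
    flip₂₃_del₃₃]

theorem coL_delR (Δ : P →ₗ[k] P ⊗[k] P) (u : P ⊗[k] P) :
    coL Δ (delR k P u) = del₃₃ k P (coL Δ u) := by
  simp only [coL_eq, flip₂_delR, coR_delL, flip₁₂_del₁₃, flip₂₃_del₂₃]

end Conformal

/-! ### Poisson conformal coalgebras and PGD-coalgebras. -/

section Coalgebra

variable {k : Type*} [Field k] {A : Type*} [AddCommGroup A] [Module k A]

theorem free_induction₁ {V : Type*} [AddCommGroup V] [Module k V] {F : Free k A → V}
    {T : Module.End k V} (h : ∀ a, F (incl k A a) = 0)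
    (add : ∀ a a', F (a + a') = F a + F a') (del : ∀ a, F (del k _ a) = T (F a)) (a : Free k A) :
    F a = 0 := by
  induction a using free_induction with
  | hadd x y hx hy => rw [add, hx, hy, add_zero]
  | hdel x hx => rw [del, hx, map_zero]
  | hincl a => exact h a

/-- The inclusion `A ⊗ A ⊗ A → P ⊗ P ⊗ P` for `P = k[∂] ⊗ A`. -/
def incl₃ : A ⊗[k] (A ⊗[k] A) →ₗ[k] Free k A ⊗[k] (Free k A ⊗[k] Free k A) :=
  TensorProduct.map (incl k A) incl₂

theorem flip₂_incl₂ (t : A ⊗[k] A) : flip₂ (incl₂ t) = incl₂ (flip₂ t) :=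
  tensor₂_ext (f := flip₂ ∘ₗ incl₂) (g := incl₂ ∘ₗ flip₂) (fun x y => by simp [incl₂]) t

theorem flip₁₂_incl₃ (t : A ⊗[k] (A ⊗[k] A)) : flip₁₂ (incl₃ t) = incl₃ (flip₁₂ t) :=
  tensor₃_ext (f := flip₁₂ ∘ₗ incl₃) (g := incl₃ ∘ₗ flip₁₂)
    (fun x y z => by simp [incl₃, incl₂]) t

theorem flip₂₃_incl₃ (t : A ⊗[k] (A ⊗[k] A)) : flip₂₃ (incl₃ t) = incl₃ (flip₂₃ t) :=
  tensor₃_ext (f := flip₂₃ ∘ₗ incl₃) (g := incl₃ ∘ₗ flip₂₃)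
    (fun x y z => by simp [incl₃, incl₂, flip₂₃]) t

theorem incl₂_injective : Function.Injective (incl₂ (k := k) (A := A)) := by
  refine Function.LeftInverse.injective
    (g := TensorProduct.map (freeCoeff k A 0) (freeCoeff k A 0)) fun t => ?_
  exact tensor₂_ext (f := TensorProduct.map (freeCoeff k A 0) (freeCoeff k A 0) ∘ₗ incl₂)
    (g := LinearMap.id) (fun x y => by simp [incl₂, freeCoeff_incl_zero]) t

theorem isCoeff_del₃ : IsCoeff (del₁₃ k (Free k A)) (del₂₃ k _) (del₃₃ k _) (incl₃ (k := k) (A := A))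
    (fun i j l => TensorProduct.map (freeCoeff k A i)
      (TensorProduct.map (freeCoeff k A j) (freeCoeff k A l))) where
  base t := tensor₃_ext (g := LinearMap.id) (f := TensorProduct.map (freeCoeff k A 0)
    (TensorProduct.map (freeCoeff k A 0) (freeCoeff k A 0)) ∘ₗ incl₃)
    (fun x y z => by simp [incl₃, incl₂, freeCoeff_incl_zero]) t
  base₁ i j l t := tensor₃_ext (g := 0) (f := TensorProduct.map (freeCoeff k A (i + 1))
    (TensorProduct.map (freeCoeff k A j) (freeCoeff k A l)) ∘ₗ incl₃)
    (fun x y z => by simp [incl₃, incl₂, freeCoeff_incl_succ]) t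
  base₂ i j l t := tensor₃_ext (g := 0) (f := TensorProduct.map (freeCoeff k A i)
    (TensorProduct.map (freeCoeff k A (j + 1)) (freeCoeff k A l)) ∘ₗ incl₃)
    (fun x y z => by simp [incl₃, incl₂, freeCoeff_incl_succ]) t
  base₃ i j l t := tensor₃_ext (g := 0) (f := TensorProduct.map (freeCoeff k A i)
    (TensorProduct.map (freeCoeff k A j) (freeCoeff k A (l + 1))) ∘ₗ incl₃)
    (fun x y z => by simp [incl₃, incl₂, freeCoeff_incl_succ]) t
  zero₁ j l v := tensor₃_ext (g := 0) (f := TensorProduct.map (freeCoeff k A 0)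
    (TensorProduct.map (freeCoeff k A j) (freeCoeff k A l)) ∘ₗ del₁₃ k _)
    (fun x y z => by simp [del₁₃, freeCoeff_del_zero]) v
  zero₂ i l v := tensor₃_ext (g := 0) (f := TensorProduct.map (freeCoeff k A i)
    (TensorProduct.map (freeCoeff k A 0) (freeCoeff k A l)) ∘ₗ del₂₃ k _)
    (fun x y z => by simp [del₂₃, delL, freeCoeff_del_zero]) v
  zero₃ i j v := tensor₃_ext (g := 0) (f := TensorProduct.map (freeCoeff k A i)
    (TensorProduct.map (freeCoeff k A j) (freeCoeff k A 0)) ∘ₗ del₃₃ k _)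
    (fun x y z => by simp [del₃₃, delR, freeCoeff_del_zero]) v
  succ₁ i j l v := tensor₃_ext (g := TensorProduct.map (freeCoeff k A i)
    (TensorProduct.map (freeCoeff k A j) (freeCoeff k A l)))
    (f := TensorProduct.map (freeCoeff k A (i + 1))
    (TensorProduct.map (freeCoeff k A j) (freeCoeff k A l)) ∘ₗ del₁₃ k _)
    (fun x y z => by simp [del₁₃, freeCoeff_del_succ]) v
  succ₂ i j l v := tensor₃_ext (g := TensorProduct.map (freeCoeff k A i)
    (TensorProduct.map (freeCoeff k A j) (freeCoeff k A l)))
    (f := TensorProduct.map (freeCoeff k A i)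
    (TensorProduct.map (freeCoeff k A (j + 1)) (freeCoeff k A l)) ∘ₗ del₂₃ k _)
    (fun x y z => by simp [del₂₃, delL, freeCoeff_del_succ]) v
  succ₃ i j l v := tensor₃_ext (g := TensorProduct.map (freeCoeff k A i)
    (TensorProduct.map (freeCoeff k A j) (freeCoeff k A l)))
    (f := TensorProduct.map (freeCoeff k A i)
    (TensorProduct.map (freeCoeff k A j) (freeCoeff k A (l + 1))) ∘ₗ del₃₃ k _)
    (fun x y z => by simp [del₃₃, delR, freeCoeff_del_succ]) v

variable (Δ₁ Δ₂ δ₀ : A →ₗ[k] A ⊗[k] A)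

theorem corrCobracket_incl (a : A) :
    corrCobracket Δ₁ δ₀ (incl k A a) =
      delL k _ (incl₂ (Δ₁ a)) - delR k _ (incl₂ (flip₂ (Δ₁ a))) + incl₂ (δ₀ a) := by
  rw [corrCobracket, delExt_incl, ← flip₂_incl₂, ← flip₂_delL]
  rfl

theorem corrComul_incl (a : A) : corrComul Δ₂ (incl k A a) = incl₂ (Δ₂ a) := by
  rw [corrComul, delExt_incl]
  rfl

theorem isDelHom_corrCobracket : IsDelHom (corrCobracket Δ₁ δ₀) := isDelHom_delExt _

theorem isDelHom_corrComul : IsDelHom (corrComul Δ₂) := isDelHom_delExt _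

theorem coR_corrCobracket (t : A ⊗[k] A) :
    coR (corrCobracket Δ₁ δ₀) (incl₂ t) =
      del₂₃ k _ (incl₃ (coR Δ₁ t)) - del₃₃ k _ (incl₃ (flip₂₃ (coR Δ₁ t))) +
        incl₃ (coR δ₀ t) :=
  tensor₂_ext (f := coR (corrCobracket Δ₁ δ₀) ∘ₗ incl₂)
    (g := del₂₃ k _ ∘ₗ incl₃ ∘ₗ coR Δ₁ - del₃₃ k _ ∘ₗ incl₃ ∘ₗ flip₂₃ ∘ₗ coR Δ₁ +
      incl₃ ∘ₗ coR δ₀)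
    (fun x y => by
      simp [coR, incl₂, incl₃, corrCobracket_incl, del₂₃, del₃₃, flip₂₃, TensorProduct.tmul_add,
        TensorProduct.tmul_sub]) t

theorem coR_corrComul (t : A ⊗[k] A) :
    coR (corrComul Δ₂) (incl₂ t) = incl₃ (coR Δ₂ t) :=
  tensor₂_ext (f := coR (corrComul Δ₂) ∘ₗ incl₂) (g := incl₃ ∘ₗ coR Δ₂)
    (fun x y => by simp [coR, incl₂, incl₃, corrComul_incl]) t

theorem coL_corrCobracket (t : A ⊗[k] A) :
    coL (corrCobracket Δ₁ δ₀) (incl₂ t) =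
      del₁₃ k _ (incl₃ (coL Δ₁ t)) - del₂₃ k _ (incl₃ (flip₁₂ (coL Δ₁ t))) +
        incl₃ (coL δ₀ t) := by
  simp only [coL_eq, flip₂_incl₂, coR_corrCobracket, map_add, map_sub, flip₁₂_del₂₃, flip₁₂_del₃₃,
    flip₂₃_del₁₃, flip₂₃_del₃₃, flip₁₂_incl₃, flip₂₃_incl₃, flip_braid]

theorem coL_corrComul (t : A ⊗[k] A) :
    coL (corrComul Δ₂) (incl₂ t) = incl₃ (coL Δ₂ t) := by
  simp only [coL_eq, flip₂_incl₂, coR_corrComul, flip₁₂_incl₃, flip₂₃_incl₃]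

variable {Δ₁ Δ₂ δ₀}

/-- The part of the cobracket containing `∂` is of the form `x - τ x`, so it is skew by construction
and only `δ₀` imposes a condition. -/
theorem corrCobracket_coskew_iff :
    (∀ a, corrCobracket Δ₁ δ₀ a = -flip₂ (corrCobracket Δ₁ δ₀ a)) ↔
      ∀ a, δ₀ a = -flip₂ (δ₀ a) := by
  have key : ∀ a, corrCobracket Δ₁ δ₀ (incl k A a) + flip₂ (corrCobracket Δ₁ δ₀ (incl k A a)) =
      incl₂ (δ₀ a + flip₂ (δ₀ a)) := fun a => by
    simp only [corrCobracket_incl, map_add, map_sub, flip₂_delL, flip₂_delR, flip₂_incl₂,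
      flip₂_flip₂]
    abel
  simp only [← add_eq_zero_iff_eq_neg]
  refine ⟨fun h a => incl₂_injective ?_, fun h => ?_⟩
  · rw [← key, h, map_zero]
  · refine free_induction₁ (T := del₂ k _) ?_ ?_ ?_
    · intro a; rw [key, h, map_zero]
    · intros; simp only [map_add]; abel
    · intros
      simp only [isDelHom_corrCobracket _ _ _, map_add, del₂_apply, flip₂_delL, flip₂_delR]; abel

theorem corrComul_cocomm_iff :
    (∀ a, corrComul Δ₂ a = flip₂ (corrComul Δ₂ a)) ↔ ∀ a, Δ₂ a = flip₂ (Δ₂ a) := by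
  have key : ∀ a, corrComul Δ₂ (incl k A a) - flip₂ (corrComul Δ₂ (incl k A a)) =
      incl₂ (Δ₂ a - flip₂ (Δ₂ a)) := fun a => by
    simp only [corrComul_incl, map_sub, flip₂_incl₂]
  simp only [← sub_eq_zero (b := flip₂ _)]
  refine ⟨fun h a => incl₂_injective ?_, fun h => ?_⟩
  · rw [← key, h, map_zero]
  · refine free_induction₁ (T := del₂ k _) ?_ ?_ ?_
    · intro a; rw [key, h, map_zero]
    · intros; simp only [map_add]; abel
    · intros
      simp only [isDelHom_corrComul _ _, map_add, map_sub, del₂_apply, flip₂_delL, flip₂_delR]; abel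

theorem corrComul_coassoc_iff :
    (∀ a, coR (corrComul Δ₂) (corrComul Δ₂ a) = coL (corrComul Δ₂) (corrComul Δ₂ a)) ↔
      ∀ a, coL Δ₂ (Δ₂ a) = coR Δ₂ (Δ₂ a) := by
  have hd := isDelHom_corrComul Δ₂
  have key : ∀ a, coR (corrComul Δ₂) (corrComul Δ₂ (incl k A a)) -
      coL (corrComul Δ₂) (corrComul Δ₂ (incl k A a)) =
      incl₃ (coR Δ₂ (Δ₂ a) - coL Δ₂ (Δ₂ a)) := fun a => by
    simp only [corrComul_incl, map_sub, coR_corrComul, coL_corrComul]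
  refine ⟨fun h a => ?_, fun h a => ?_⟩
  · have := key a
    rw [h, sub_self] at this
    have h' := isCoeff_del₃.base (coR Δ₂ (Δ₂ a) - coL Δ₂ (Δ₂ a))
    rw [← this, map_zero] at h'
    exact (sub_eq_zero.1 h'.symm).symm
  · refine sub_eq_zero.1 (free_induction₁ (T := del₁₃ k _ + del₂₃ k _ + del₃₃ k _)
      (F := fun a => coR (corrComul Δ₂) (corrComul Δ₂ a) - coL (corrComul Δ₂) (corrComul Δ₂ a))
      ?_ ?_ ?_ a)
    · intro a; rw [key, h, sub_self, map_zero]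
    · intros; simp only [map_add]; abel
    · intros
      simp only [hd _, map_add, map_sub, del₂_apply, coR_delL, coR_delR hd, coL_delL hd, coL_delR,
        LinearMap.add_apply]
      abel

/-- Writing `∂₁`, `∂₂`, `∂₃` for `∂` on the three factors, the constant coefficient is co-Jacobi for
`δ₀`, that of `∂₁` is the Gel'fand-Dorfman condition, and those of `∂₁²` and `∂₁∂₂` are
right-commutativity and left-symmetry of `Δ₁`. For skew `δ₀` the symmetric group permutes the three
linear, the three square and the three mixed coefficients up to sign, so nothing else is imposed. -/
theorem corr_cojacobi_iff (hδ : ∀ a, δ₀ a = -flip₂ (δ₀ a)) :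
    (∀ a, coR (corrCobracket Δ₁ δ₀) (corrCobracket Δ₁ δ₀ a) -
      flip₁₂ (coR (corrCobracket Δ₁ δ₀) (corrCobracket Δ₁ δ₀ a)) =
        coL (corrCobracket Δ₁ δ₀) (corrCobracket Δ₁ δ₀ a)) ↔
    (∀ a, coR δ₀ (δ₀ a) - flip₁₂ (coR δ₀ (δ₀ a)) = coL δ₀ (δ₀ a)) ∧ IsNovikovCoalgebra Δ₁ ∧
      ∀ a, coR δ₀ (Δ₁ a) - flip₁₂ (coR Δ₁ (δ₀ a)) + flip₁₂ (coR δ₀ (flip₂ (Δ₁ a))) =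
        coL Δ₁ (δ₀ a) + coL δ₀ (Δ₁ a) := by
  have hd := isDelHom_corrCobracket Δ₁ δ₀
  have hδ' : ∀ a, flip₂ (δ₀ a) = -δ₀ a := fun a => by
    conv_rhs => rw [hδ a, neg_neg]
  have key : ∀ a, coR (corrCobracket Δ₁ δ₀) (corrCobracket Δ₁ δ₀ (incl k A a)) -
      flip₁₂ (coR (corrCobracket Δ₁ δ₀) (corrCobracket Δ₁ δ₀ (incl k A a))) -
        coL (corrCobracket Δ₁ δ₀) (corrCobracket Δ₁ δ₀ (incl k A a)) =
      quad (del₁₃ k _) (del₂₃ k _) (del₃₃ k _) incl₃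
        (coR δ₀ (δ₀ a) - flip₁₂ (coR δ₀ (δ₀ a)) - coL δ₀ (δ₀ a))
        (coR δ₀ (Δ₁ a) - flip₁₂ (coR Δ₁ (δ₀ a)) + flip₁₂ (coR δ₀ (flip₂ (Δ₁ a))) -
          coL Δ₁ (δ₀ a) - coL δ₀ (Δ₁ a))
        (-coR δ₀ (flip₂ (Δ₁ a)) + coR Δ₁ (δ₀ a) - flip₁₂ (coR δ₀ (Δ₁ a)) -
          coL δ₀ (Δ₁ a) + flip₁₂ (coL Δ₁ (δ₀ a)))
        (-coR δ₀ (flip₂ (Δ₁ a)) - flip₂₃ (coR Δ₁ (δ₀ a)) + flip₁₂ (coR δ₀ (flip₂ (Δ₁ a))) +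
          flip₁₂ (flip₂₃ (coR Δ₁ (δ₀ a))) + coL δ₀ (flip₂ (Δ₁ a)))
        (flip₁₂ (coR Δ₁ (flip₂ (Δ₁ a))) - coL Δ₁ (Δ₁ a))
        (coR Δ₁ (Δ₁ a) - flip₁₂ (coR Δ₁ (Δ₁ a)) + flip₁₂ (coL Δ₁ (Δ₁ a)) - coL Δ₁ (Δ₁ a))
        (-flip₂₃ (coR Δ₁ (Δ₁ a)) + flip₁₂ (coR Δ₁ (flip₂ (Δ₁ a))) -
          flip₁₂ (flip₂₃ (coR Δ₁ (flip₂ (Δ₁ a)))) + coL Δ₁ (flip₂ (Δ₁ a)))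
        (-coR Δ₁ (flip₂ (Δ₁ a)) + flip₁₂ (coL Δ₁ (Δ₁ a)))
        (-coR Δ₁ (flip₂ (Δ₁ a)) + flip₂₃ (coR Δ₁ (flip₂ (Δ₁ a))) +
          flip₁₂ (flip₂₃ (coR Δ₁ (Δ₁ a))) - flip₁₂ (coL Δ₁ (flip₂ (Δ₁ a))))
        (flip₂₃ (coR Δ₁ (flip₂ (Δ₁ a))) - flip₁₂ (flip₂₃ (coR Δ₁ (flip₂ (Δ₁ a))))) := fun a => by
    simp only [quad, corrCobracket_incl, map_sub, map_add, map_neg, coR_delL, coR_delR hd,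
      coL_delL hd, coL_delR, coR_corrCobracket, coL_corrCobracket, flip₁₂_del₁₃, flip₁₂_del₂₃,
      flip₁₂_del₃₃, flip₁₂_incl₃, del₂₃_del₁₃, del₃₃_del₁₃, del₃₃_del₂₃]
    abel
  constructor
  · intro h
    have h' := fun a => isCoeff_del₃.quad_eq_zero_iff.1 ((key a).symm.trans (by rw [h, sub_self]))
    refine ⟨fun a => ?_, ⟨fun a => ?_, fun a => ?_⟩, fun a => ?_⟩
    · exact sub_eq_zero.1 (h' a).1
    · linear_combination (norm := module) (h' a).2.2.2.2.2.1
    · exact sub_eq_zero.1 (h' a).2.2.2.2.1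
    · linear_combination (norm := module) (h' a).2.1
  · rintro ⟨h₀, ⟨hl, hr⟩, hc⟩ a
    refine sub_eq_zero.1 (free_induction₁ (T := del₁₃ k _ + del₂₃ k _ + del₃₃ k _)
      (F := fun a => coR (corrCobracket Δ₁ δ₀) (corrCobracket Δ₁ δ₀ a) -
        flip₁₂ (coR (corrCobracket Δ₁ δ₀) (corrCobracket Δ₁ δ₀ a)) -
        coL (corrCobracket Δ₁ δ₀) (corrCobracket Δ₁ δ₀ a)) ?_ ?_ ?_ a)
    · intro a
      rw [key, isCoeff_del₃.quad_eq_zero_iff]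
      have hl := hl a
      have hr := hr a
      have hc := hc a
      simp only [coL_eq, hδ', flip₂_flip₂, map_neg] at hl hr hc ⊢
      -- The permuted forms of the three identities, which supply the coefficients at the other
      -- monomials.
      have hr' := congrArg flip₁₂ hr
      have hr'' := congrArg flip₂₃ hr'
      have hl' := congrArg flip₂₃ hl
      have hl'' := congrArg flip₁₂ hl'
      have hc₁ := congrArg flip₁₂ hc
      have hc₂ := congrArg flip₂₃ hc₁
      -- The simplification below orients the braid relation so that `flip₁₂` is innermost. This
      -- hides the `flip₂₃` which skewness of `δ₀` would absorb, hence the separate identity.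
      have hx : flip₁₂ (flip₂₃ (flip₁₂ (coR δ₀ (flip₂ (Δ₁ a))))) =
          -flip₂₃ (flip₁₂ (coR δ₀ (flip₂ (Δ₁ a)))) := by
        rw [← flip_braid, flip₂₃_coR_of_skew hδ, map_neg, map_neg]
      simp only [map_sub, map_add, map_neg, flip₁₂_flip₁₂, flip₂₃_flip₂₃, flip_braid,
        flip₂₃_coR_of_skew hδ] at *
      refine ⟨?_, ?_, ?_, ?_, ?_, ?_, ?_, ?_, ?_, ?_⟩
      · have := h₀ a
        simp only [coL_eq, hδ', map_neg] at this
        linear_combination (norm := module) this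
      · linear_combination (norm := module) hc
      · linear_combination (norm := module) -hc₁ - hx
      · linear_combination (norm := module) hc₂
      · linear_combination (norm := module) hr
      · linear_combination (norm := module) hl
      · linear_combination (norm := module) -hl'
      · linear_combination (norm := module) -hr'
      · linear_combination (norm := module) hl''
      · linear_combination (norm := module) hr''
    · intros; simp only [map_add]; abel
    · intros
      simp only [hd _, map_add, map_sub, del₂_apply, coR_delL, coR_delR hd, coL_delL hd, coL_delR,
        flip₁₂_del₁₃, flip₁₂_del₂₃, flip₁₂_del₃₃, LinearMap.add_apply]
      abel

/-- The difference is linear in the three copies of `∂`. The constant coefficient and those of the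
first two copies are the three conditions; the third coefficient is the `flip₂₃`-image of the
second, by cocommutativity of `Δ₂`. -/
theorem corr_coleibniz_iff (hΔ : ∀ a, Δ₂ a = flip₂ (Δ₂ a)) :
    (∀ a, coR (corrComul Δ₂) (corrCobracket Δ₁ δ₀ a) = coL (corrCobracket Δ₁ δ₀) (corrComul Δ₂ a) +
      flip₁₂ (coR (corrCobracket Δ₁ δ₀) (corrComul Δ₂ a))) ↔
    (∀ a, coR Δ₂ (δ₀ a) = coL δ₀ (Δ₂ a) + flip₁₂ (coR δ₀ (Δ₂ a))) ∧
    (∀ a, coR Δ₂ (Δ₁ a) = coL Δ₁ (Δ₂ a) + flip₁₂ (coR Δ₁ (Δ₂ a))) ∧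
      ∀ a, coR Δ₂ (flip₂ (Δ₁ a)) = flip₁₂ (coL Δ₁ (Δ₂ a)) := by
  have hd := isDelHom_corrCobracket Δ₁ δ₀
  have hd' := isDelHom_corrComul Δ₂
  have key : ∀ a, coR (corrComul Δ₂) (corrCobracket Δ₁ δ₀ (incl k A a)) -
      (coL (corrCobracket Δ₁ δ₀) (corrComul Δ₂ (incl k A a)) +
        flip₁₂ (coR (corrCobracket Δ₁ δ₀) (corrComul Δ₂ (incl k A a)))) =
      quad (del₁₃ k _) (del₂₃ k _) (del₃₃ k _) incl₃
        (coR Δ₂ (δ₀ a) - (coL δ₀ (Δ₂ a) + flip₁₂ (coR δ₀ (Δ₂ a))))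
        (coR Δ₂ (Δ₁ a) - (coL Δ₁ (Δ₂ a) + flip₁₂ (coR Δ₁ (Δ₂ a))))
        (-coR Δ₂ (flip₂ (Δ₁ a)) + flip₁₂ (coL Δ₁ (Δ₂ a)))
        (-coR Δ₂ (flip₂ (Δ₁ a)) + flip₁₂ (flip₂₃ (coR Δ₁ (Δ₂ a)))) 0 0 0 0 0 0 := fun a => by
    simp only [quad, corrCobracket_incl, corrComul_incl, map_sub, map_add, map_neg, map_zero,
      coR_delL, coR_delR hd', coR_corrCobracket, coL_corrCobracket, coR_corrComul,
      flip₁₂_del₂₃, flip₁₂_del₃₃, flip₁₂_incl₃]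
    abel
  constructor
  · intro h
    have h' := fun a => isCoeff_del₃.quad_eq_zero_iff.1 ((key a).symm.trans (by rw [h, sub_self]))
    refine ⟨fun a => sub_eq_zero.1 (h' a).1, fun a => sub_eq_zero.1 (h' a).2.1, fun a => ?_⟩
    linear_combination (norm := module) -(h' a).2.2.1
  · rintro ⟨h₀, h₁, h₂⟩ a
    refine sub_eq_zero.1 (free_induction₁ (T := del₁₃ k _ + del₂₃ k _ + del₃₃ k _)
      (F := fun a => coR (corrComul Δ₂) (corrCobracket Δ₁ δ₀ a) -
      (coL (corrCobracket Δ₁ δ₀) (corrComul Δ₂ a) +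
        flip₁₂ (coR (corrCobracket Δ₁ δ₀) (corrComul Δ₂ a)))) ?_ ?_ ?_ a)
    · intro a
      rw [key, isCoeff_del₃.quad_eq_zero_iff]
      refine ⟨sub_eq_zero.2 (h₀ a), sub_eq_zero.2 (h₁ a), ?_, ?_, rfl, rfl, rfl, rfl, rfl, rfl⟩
      · rw [h₂]; abel
      · have := congrArg flip₂₃ (h₂ a)
        rw [flip₂₃_coR_of_symm hΔ, coL_eq, ← hΔ] at this
        rw [this, flip_braid, flip₁₂_flip₁₂, neg_add_cancel]
    · intros; simp only [map_add]; abel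
    · intros
      simp only [hd _, hd' _, map_add, map_sub, del₂_apply, coR_delL, coR_delR hd, coR_delR hd',
        coL_delL hd, coL_delR, flip₁₂_del₁₃, flip₁₂_del₂₃, flip₁₂_del₃₃, LinearMap.add_apply]
      abel

theorem isPoissonConformalCoalgebra_corr_iff :
    IsPoissonConformalCoalgebra (corrCobracket Δ₁ δ₀) (corrComul Δ₂) ↔
      IsGDCoalgebra Δ₁ δ₀ ∧ IsPoissonCoalgebra Δ₂ δ₀ ∧ IsDiffNovikovPoissonCoalgebra Δ₁ Δ₂ := by
  constructor
  · rintro ⟨⟨-, h₁, h₂⟩, ⟨⟨-, h₃⟩, h₄⟩, h₅⟩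
    -- Skewness of `δ₀` and symmetry of `Δ₂` come first, being hypotheses of the two larger
    -- equivalences.
    have h₁ := corrCobracket_coskew_iff.1 h₁
    have h₄ := corrComul_cocomm_iff.1 h₄
    have h₃ := corrComul_coassoc_iff.1 h₃
    obtain ⟨j₀, j₁, j₂⟩ := (corr_cojacobi_iff h₁).1 h₂
    obtain ⟨l₀, l₁, l₂⟩ := (corr_coleibniz_iff h₄).1 h₅
    exact ⟨⟨j₁, ⟨h₁, j₀⟩, j₂⟩, ⟨⟨h₃, h₄⟩, ⟨h₁, j₀⟩, l₀⟩, ⟨j₁, ⟨h₃, h₄⟩, l₁, l₂⟩⟩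
  · rintro ⟨⟨j₁, ⟨h₁, j₀⟩, j₂⟩, ⟨⟨h₃, h₄⟩, -, l₀⟩, ⟨-, -, l₁, l₂⟩⟩
    exact ⟨⟨isDelHom_corrCobracket _ _, corrCobracket_coskew_iff.2 h₁,
      (corr_cojacobi_iff h₁).2 ⟨j₀, j₁, j₂⟩⟩,
      ⟨⟨isDelHom_corrComul _, corrComul_coassoc_iff.2 h₃⟩, corrComul_cocomm_iff.2 h₄⟩,
      (corr_coleibniz_iff h₄).2 ⟨l₀, l₁, l₂⟩⟩

end Coalgebra

/-! ### Sesquilinearity of the actions on `P ⊗ P`. -/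

section Actions

variable {k : Type*} [Field k] {P : Type*} [AddCommGroup P] [Module k P]

theorem actL_tmul (m : LamProd k P) (T : Module.End k (Poly k (P ⊗[k] P))) (a x y : P) :
    actL m T a (x ⊗ₜ y) =
      subst T (const k (P ⊗[k] P) ∘ₗ (TensorProduct.mk k P P).flip y) (m a x) := by
  simp only [actL, LinearMap.comp_apply, LinearMap.rTensor_tmul]
  generalize m a x = u
  induction u using TensorProduct.induction_on with
  | zero => simp
  | add u v hu hv => simp only [TensorProduct.add_tmul, map_add, hu, hv]
  | tmul f x => simp [subst_tmul]

theorem actR_tmul (m : LamProd k P) (T : Module.End k (Poly k (P ⊗[k] P))) (a x y : P) :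
    actR m T a (x ⊗ₜ y) =
      subst T (const k (P ⊗[k] P) ∘ₗ TensorProduct.mk k P P x) (m a y) := by
  simp only [actR, LinearMap.comp_apply, LinearMap.lTensor_tmul]
  generalize m a y = u
  induction u using TensorProduct.induction_on with
  | zero => simp
  | add u v hu hv => simp only [TensorProduct.tmul_add, map_add, hu, hv]
  | tmul f x => simp [subst_tmul]

theorem actL_add_left (m : LamProd k P) (T : Module.End k (Poly k (P ⊗[k] P))) (a a' : P)
    (u : P ⊗[k] P) : actL m T (a + a') u = actL m T a u + actL m T a' u :=
  tensor₂_ext (f := actL m T (a + a')) (g := actL m T a + actL m T a')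
    (fun x y => by simp [actL_tmul]) u

theorem actR_add_left (m : LamProd k P) (T : Module.End k (Poly k (P ⊗[k] P))) (a a' : P)
    (u : P ⊗[k] P) : actR m T (a + a') u = actR m T a u + actR m T a' u :=
  tensor₂_ext (f := actR m T (a + a')) (g := actR m T a + actR m T a')
    (fun x y => by simp [actR_tmul]) u

variable [Module k[X] P] [IsScalarTower k k[X] P]

variable (k P) in
/-- The action of `∂ ⊗ I` on the coefficients of `(P ⊗ P)[λ]`. -/
def delLPoly : Module.End k (Poly k (P ⊗[k] P)) := (delL k P).lTensor k[X]

variable (k P) in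
/-- The action of `I ⊗ ∂` on the coefficients of `(P ⊗ P)[λ]`. -/
def delRPoly : Module.End k (Poly k (P ⊗[k] P)) := (delR k P).lTensor k[X]

theorem del₂Poly_apply (u : Poly k (P ⊗[k] P)) :
    del₂Poly k P u = delLPoly k P u + delRPoly k P u := by
  rw [del₂Poly, del₂, LinearMap.lTensor_add]; rfl

theorem negLamDel_apply (u : Poly k (P ⊗[k] P)) :
    negLamDel k P u = -lam k _ u - delLPoly k P u - delRPoly k P u := by
  rw [LinearMap.sub_apply, LinearMap.neg_apply, del₂Poly_apply]; abel

theorem delLPoly_lam (u : Poly k (P ⊗[k] P)) :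
    delLPoly k P (lam k _ u) = lam k _ (delLPoly k P u) := lTensor_lam _ _

theorem delRPoly_lam (u : Poly k (P ⊗[k] P)) :
    delRPoly k P (lam k _ u) = lam k _ (delRPoly k P u) := lTensor_lam _ _

theorem delRPoly_delLPoly (u : Poly k (P ⊗[k] P)) :
    delRPoly k P (delLPoly k P u) = delLPoly k P (delRPoly k P u) := by
  rw [delLPoly, delRPoly, ← LinearMap.comp_apply, ← LinearMap.comp_apply, ← LinearMap.lTensor_comp,
    ← LinearMap.lTensor_comp]
  congr 2
  exact LinearMap.ext delR_delL

theorem delLPoly_negLamDel (u : Poly k (P ⊗[k] P)) :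
    delLPoly k P (negLamDel k P u) = negLamDel k P (delLPoly k P u) := by
  simp only [negLamDel_apply, map_sub, map_neg, delLPoly_lam, delRPoly_delLPoly]

theorem delRPoly_negLamDel (u : Poly k (P ⊗[k] P)) :
    delRPoly k P (negLamDel k P u) = negLamDel k P (delRPoly k P u) := by
  simp only [negLamDel_apply, map_sub, map_neg, delRPoly_lam, delRPoly_delLPoly]

theorem delLPoly_const (u : P ⊗[k] P) :
    delLPoly k P (const k _ u) = const k _ (delL k P u) := lTensor_const _ _

theorem delRPoly_const (u : P ⊗[k] P) :
    delRPoly k P (const k _ u) = const k _ (delR k P u) := lTensor_const _ _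

variable {m : LamProd k P} {T : Module.End k (Poly k (P ⊗[k] P))}

theorem actL_delL (hm : IsSesquilinear m) (hT : ∀ u, delLPoly k P (T u) = T (delLPoly k P u))
    (a : P) (u : P ⊗[k] P) :
    actL m T a (delL k P u) = delLPoly k P (actL m T a u) + T (actL m T a u) :=
  tensor₂_ext (f := actL m T a ∘ₗ delL k P) (g := delLPoly k P ∘ₗ actL m T a + T ∘ₗ actL m T a)
    (fun x y => by
      simp only [LinearMap.comp_apply, LinearMap.add_apply, delL, LinearMap.rTensor_tmul, actL_tmul,
        hm.del_right, map_add, subst_lam, subst_delPoly, ← subst_intertwine hT]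
      congr 2) u

theorem actL_delR (hT : ∀ u, delRPoly k P (T u) = T (delRPoly k P u)) (a : P) (u : P ⊗[k] P) :
    actL m T a (delR k P u) = delRPoly k P (actL m T a u) :=
  tensor₂_ext (f := actL m T a ∘ₗ delR k P) (g := delRPoly k P ∘ₗ actL m T a)
    (fun x y => by
      simp only [LinearMap.comp_apply, delR, LinearMap.lTensor_tmul, actL_tmul,
        ← subst_intertwine hT]
      congr 2) u

theorem actR_delR (hm : IsSesquilinear m) (hT : ∀ u, delRPoly k P (T u) = T (delRPoly k P u))
    (a : P) (u : P ⊗[k] P) :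
    actR m T a (delR k P u) = delRPoly k P (actR m T a u) + T (actR m T a u) :=
  tensor₂_ext (f := actR m T a ∘ₗ delR k P) (g := delRPoly k P ∘ₗ actR m T a + T ∘ₗ actR m T a)
    (fun x y => by
      simp only [LinearMap.comp_apply, LinearMap.add_apply, delR, LinearMap.lTensor_tmul, actR_tmul,
        hm.del_right, map_add, subst_lam, subst_delPoly, ← subst_intertwine hT]
      congr 2) u

theorem actR_delL (hT : ∀ u, delLPoly k P (T u) = T (delLPoly k P u)) (a : P) (u : P ⊗[k] P) :
    actR m T a (delL k P u) = delLPoly k P (actR m T a u) :=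
  tensor₂_ext (f := actR m T a ∘ₗ delL k P) (g := delLPoly k P ∘ₗ actR m T a)
    (fun x y => by
      simp only [LinearMap.comp_apply, delL, LinearMap.rTensor_tmul, actR_tmul,
        ← subst_intertwine hT]
      congr 2) u

theorem actL_del_left (hm : IsSesquilinear m) (a : P) (u : P ⊗[k] P) :
    actL m T (del k P a) u = -T (actL m T a u) :=
  tensor₂_ext (f := actL m T (del k P a)) (g := -(T ∘ₗ actL m T a))
    (fun x y => by simp [actL_tmul, hm.del_left, subst_lam]) u

theorem actR_del_left (hm : IsSesquilinear m) (a : P) (u : P ⊗[k] P) :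
    actR m T (del k P a) u = -T (actR m T a u) :=
  tensor₂_ext (f := actR m T (del k P a)) (g := -(T ∘ₗ actR m T a))
    (fun x y => by simp [actR_tmul, hm.del_left, subst_lam]) u

theorem lTensor_delPoly {D : P →ₗ[k] P ⊗[k] P} (h : IsDelHom D) (u : Poly k P) :
    D.lTensor k[X] (delPoly k P u) =
      delLPoly k P (D.lTensor k[X] u) + delRPoly k P (D.lTensor k[X] u) := by
  rw [← del₂Poly_apply, delPoly, del₂Poly, ← LinearMap.comp_apply, ← LinearMap.comp_apply,
    ← LinearMap.lTensor_comp, ← LinearMap.lTensor_comp]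
  congr 2
  exact LinearMap.ext h

theorem lTensor_flip₂_delLPoly (u : Poly k (P ⊗[k] P)) :
    (flip₂ (k := k) (V := P)).lTensor k[X] (delLPoly k P u) =
      delRPoly k P ((flip₂ (k := k) (V := P)).lTensor k[X] u) := by
  rw [delLPoly, delRPoly, ← LinearMap.comp_apply, ← LinearMap.comp_apply, ← LinearMap.lTensor_comp,
    ← LinearMap.lTensor_comp]
  congr 2
  exact LinearMap.ext flip₂_delL

theorem lTensor_flip₂_delRPoly (u : Poly k (P ⊗[k] P)) :
    (flip₂ (k := k) (V := P)).lTensor k[X] (delRPoly k P u) =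
      delLPoly k P ((flip₂ (k := k) (V := P)).lTensor k[X] u) := by
  rw [delLPoly, delRPoly, ← LinearMap.comp_apply, ← LinearMap.comp_apply, ← LinearMap.lTensor_comp,
    ← LinearMap.lTensor_comp]
  congr 2
  exact LinearMap.ext flip₂_delR

/-- Sesquilinear maps `P × P → (P ⊗ P)[λ]`. -/
structure IsSesquilinear₂ (F : P → P → Poly k (P ⊗[k] P)) : Prop where
  add_left : ∀ a a' b, F (a + a') b = F a b + F a' b
  add_right : ∀ a b b', F a (b + b') = F a b + F a b'
  del_left : ∀ a b, F (del k P a) b = -lam k _ (F a b)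
  del_right : ∀ a b, F a (del k P b) =
    delLPoly k P (F a b) + delRPoly k P (F a b) + lam k _ (F a b)

namespace IsSesquilinear₂

variable {F G : P → P → Poly k (P ⊗[k] P)}

theorem add (hF : IsSesquilinear₂ F) (hG : IsSesquilinear₂ G) :
    IsSesquilinear₂ fun a b => F a b + G a b where
  add_left a a' b := by rw [hF.add_left, hG.add_left]; abel
  add_right a b b' := by rw [hF.add_right, hG.add_right]; abel
  del_left a b := by rw [hF.del_left, hG.del_left, map_add]; abel
  del_right a b := by rw [hF.del_right, hG.del_right]; simp only [map_add]; abel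

theorem sub (hF : IsSesquilinear₂ F) (hG : IsSesquilinear₂ G) :
    IsSesquilinear₂ fun a b => F a b - G a b where
  add_left a a' b := by rw [hF.add_left, hG.add_left]; abel
  add_right a b b' := by rw [hF.add_right, hG.add_right]; abel
  del_left a b := by rw [hF.del_left, hG.del_left, map_sub]; abel
  del_right a b := by rw [hF.del_right, hG.del_right]; simp only [map_sub]; abel

theorem zero : IsSesquilinear₂ fun _ _ => (0 : Poly k (P ⊗[k] P)) where
  add_left := by simp
  add_right := by simp
  del_left := by simp
  del_right := by simp

theorem flip (hF : IsSesquilinear₂ F) :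
    IsSesquilinear₂ fun a b => (flip₂ (k := k) (V := P)).lTensor k[X] (F a b) where
  add_left a a' b := by rw [hF.add_left, map_add]
  add_right a b b' := by rw [hF.add_right, map_add]
  del_left a b := by rw [hF.del_left, map_neg, lTensor_lam]
  del_right a b := by
    rw [hF.del_right, map_add, map_add, lTensor_lam, lTensor_flip₂_delLPoly,
      lTensor_flip₂_delRPoly]; abel

theorem lTensor {D : P →ₗ[k] P ⊗[k] P} (hD : IsDelHom D) (hm : IsSesquilinear m) :
    IsSesquilinear₂ fun a b => D.lTensor k[X] (m a b) where
  add_left a a' b := by simp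
  add_right a b b' := by simp
  del_left a b := by rw [hm.del_left, map_neg, lTensor_lam]
  del_right a b := by
    rw [hm.del_right, LinearMap.add_apply, map_add, lTensor_lam, lTensor_delPoly hD]

variable {D : P →ₗ[k] P ⊗[k] P}

theorem actL_lam (hD : IsDelHom D) (hm : IsSesquilinear m) :
    IsSesquilinear₂ fun a b => actL m (lamT k P) a (D b) where
  add_left a a' b := actL_add_left _ _ _ _ _
  add_right a b b' := by simp
  del_left a b := actL_del_left hm _ _
  del_right a b := by
    rw [hD, del₂_apply, map_add, actL_delL hm delLPoly_lam, actL_delR delRPoly_lam]; abel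

theorem actR_lam (hD : IsDelHom D) (hm : IsSesquilinear m) :
    IsSesquilinear₂ fun a b => actR m (lamT k P) a (D b) where
  add_left a a' b := actR_add_left _ _ _ _ _
  add_right a b b' := by simp
  del_left a b := actR_del_left hm _ _
  del_right a b := by
    rw [hD, del₂_apply, map_add, actR_delL delLPoly_lam, actR_delR hm delRPoly_lam]; abel

/-- With `ν = -λ - ∂^{⊗2}`, `∂` on `b` gives `-ν = λ + ∂^{⊗2}`, while `∂` on `a` passes through `D`
and gives `∂^{⊗2} + ν = -λ`. So this term transforms like the one with `a` acting at `λ`. -/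
theorem actL_negLamDel (hD : IsDelHom D) (hm : IsSesquilinear m) :
    IsSesquilinear₂ fun a b => actL m (negLamDel k P) b (D a) where
  add_left a a' b := by simp
  add_right a b b' := actL_add_left _ _ _ _ _
  del_left a b := by
    rw [hD, del₂_apply, map_add, actL_delL hm delLPoly_negLamDel, actL_delR delRPoly_negLamDel,
      negLamDel_apply]; abel
  del_right a b := by rw [actL_del_left hm, negLamDel_apply]; abel

theorem actR_negLamDel (hD : IsDelHom D) (hm : IsSesquilinear m) :
    IsSesquilinear₂ fun a b => actR m (negLamDel k P) b (D a) where
  add_left a a' b := by simp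
  add_right a b b' := actR_add_left _ _ _ _ _
  del_left a b := by
    rw [hD, del₂_apply, map_add, actR_delL delLPoly_negLamDel, actR_delR hm delRPoly_negLamDel,
      negLamDel_apply]; abel
  del_right a b := by rw [actR_del_left hm, negLamDel_apply]; abel

end IsSesquilinear₂

end Actions

/-! ### Coefficients in `(P ⊗ P)[λ]` and the actions of elements of `A`. -/

section Free

variable {k : Type*} [Field k] {A : Type*} [AddCommGroup A] [Module k A]

theorem IsSesquilinear₂.ext {F G : Free k A → Free k A → Poly k (Free k A ⊗[k] Free k A)}
    (hF : IsSesquilinear₂ F) (hG : IsSesquilinear₂ G)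
    (h : ∀ a b, F (incl k A a) (incl k A b) - G (incl k A a) (incl k A b) = 0)
    (a b : Free k A) : F a b = G a b :=
  have H := hF.sub hG
  sub_eq_zero.1 (free_induction₂ (F := fun a b => F a b - G a b) (S := -lam k _)
    (T := delLPoly k _ + delRPoly k _ + lam k _) h H.add_left H.add_right H.del_left
    H.del_right a b)

/-- The inclusion `A ⊗ A → (P ⊗ P)[λ]` for `P = k[∂] ⊗ A`. -/
def inclPoly : A ⊗[k] A →ₗ[k] Poly k (Free k A ⊗[k] Free k A) := const k _ ∘ₗ incl₂

/-- The coefficient of `λ ^ n (∂ ^ i ⊗ ∂ ^ j)` in `(P ⊗ P)[λ]` for `P = k[∂] ⊗ A`. -/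
def polyCoeff (n i j : ℕ) : Poly k (Free k A ⊗[k] Free k A) →ₗ[k] A ⊗[k] A :=
  (TensorProduct.lid k (A ⊗[k] A)).toLinearMap ∘ₗ TensorProduct.map (Polynomial.lcoeff k n)
    (TensorProduct.map (freeCoeff k A i) (freeCoeff k A j))

theorem polyCoeff_tmul (n i j : ℕ) (f : k[X]) (x y : Free k A) :
    polyCoeff n i j (f ⊗ₜ (x ⊗ₜ y)) =
      f.coeff n • (freeCoeff k A i x ⊗ₜ[k] freeCoeff k A j y) := by
  simp [polyCoeff]

theorem polyTensor_ext {V N : Type*} [AddCommGroup V] [Module k V] [AddCommGroup N] [Module k N]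
    {f g : Poly k (V ⊗[k] V) →ₗ[k] N}
    (h : ∀ p x y, f (p ⊗ₜ (x ⊗ₜ y)) = g (p ⊗ₜ (x ⊗ₜ y))) (t : Poly k (V ⊗[k] V)) : f t = g t :=
  LinearMap.congr_fun (TensorProduct.ext' fun p u => tensor₂_ext
    (f := f ∘ₗ TensorProduct.mk k k[X] _ p) (g := g ∘ₗ TensorProduct.mk k k[X] _ p) (h p) u) t

theorem isCoeff_poly : IsCoeff (lam k _) (delLPoly k (Free k A)) (delRPoly k _) inclPoly
    polyCoeff where
  base t := tensor₂_ext (f := polyCoeff 0 0 0 ∘ₗ inclPoly) (g := LinearMap.id)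
    (fun x y => by simp [inclPoly, const, incl₂, polyCoeff_tmul, freeCoeff_incl_zero]) t
  base₁ i j l t := tensor₂_ext (f := polyCoeff (i + 1) j l ∘ₗ inclPoly) (g := 0)
    (fun x y => by simp [inclPoly, const, incl₂, polyCoeff_tmul, Polynomial.coeff_one]) t
  base₂ i j l t := tensor₂_ext (f := polyCoeff i (j + 1) l ∘ₗ inclPoly) (g := 0)
    (fun x y => by simp [inclPoly, const, incl₂, polyCoeff_tmul, freeCoeff_incl_succ]) t
  base₃ i j l t := tensor₂_ext (f := polyCoeff i j (l + 1) ∘ₗ inclPoly) (g := 0)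
    (fun x y => by simp [inclPoly, const, incl₂, polyCoeff_tmul, freeCoeff_incl_succ]) t
  zero₁ j l v := polyTensor_ext (f := polyCoeff 0 j l ∘ₗ lam k _) (g := 0)
    (fun p x y => by simp [lam_tmul, polyCoeff_tmul]) v
  zero₂ i l v := polyTensor_ext (f := polyCoeff i 0 l ∘ₗ delLPoly k _) (g := 0)
    (fun p x y => by simp [delLPoly, delL, polyCoeff_tmul, freeCoeff_del_zero]) v
  zero₃ i j v := polyTensor_ext (f := polyCoeff i j 0 ∘ₗ delRPoly k _) (g := 0)
    (fun p x y => by simp [delRPoly, delR, polyCoeff_tmul, freeCoeff_del_zero]) v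
  succ₁ i j l v := polyTensor_ext (f := polyCoeff (i + 1) j l ∘ₗ lam k _) (g := polyCoeff i j l)
    (fun p x y => by simp [lam_tmul, polyCoeff_tmul]) v
  succ₂ i j l v := polyTensor_ext (f := polyCoeff i (j + 1) l ∘ₗ delLPoly k _)
    (g := polyCoeff i j l)
    (fun p x y => by simp [delLPoly, delL, polyCoeff_tmul, freeCoeff_del_succ]) v
  succ₃ i j l v := polyTensor_ext (f := polyCoeff i j (l + 1) ∘ₗ delRPoly k _)
    (g := polyCoeff i j l)
    (fun p x y => by simp [delRPoly, delR, polyCoeff_tmul, freeCoeff_del_succ]) v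

theorem flip₂_onL (f : A →ₗ[k] A) (t : A ⊗[k] A) : flip₂ (onL f t) = onR f (flip₂ t) :=
  tensor₂_ext (f := flip₂ ∘ₗ onL f) (g := onR f ∘ₗ flip₂) (fun x y => by simp) t

theorem flip₂_onR (f : A →ₗ[k] A) (t : A ⊗[k] A) : flip₂ (onR f t) = onL f (flip₂ t) :=
  tensor₂_ext (f := flip₂ ∘ₗ onR f) (g := onL f ∘ₗ flip₂) (fun x y => by simp) t

theorem onL_star (circ : A →ₗ[k] A →ₗ[k] A) (a : A) (t : A ⊗[k] A) :
    onL (star circ a) t = onL (circ a) t + onL (circ.flip a) t := by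
  rw [star, LinearMap.add_apply, onL, LinearMap.rTensor_add, LinearMap.add_apply]

theorem onR_star (circ : A →ₗ[k] A →ₗ[k] A) (a : A) (t : A ⊗[k] A) :
    onR (star circ a) t = onR (circ a) t + onR (circ.flip a) t := by
  rw [star, LinearMap.add_apply, onR, LinearMap.lTensor_add, LinearMap.add_apply]

variable {T : Module.End k (Poly k (Free k A ⊗[k] Free k A))}

theorem actL_corrProd (dot : A →ₗ[k] A →ₗ[k] A) (a : A) (t : A ⊗[k] A) :
    actL (corrProd dot) T (incl k A a) (incl₂ t) = inclPoly (onL (dot a) t) :=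
  tensor₂_ext (f := actL (corrProd dot) T (incl k A a) ∘ₗ incl₂) (g := inclPoly ∘ₗ onL (dot a))
    (fun x y => by simp [incl₂, inclPoly, actL_tmul, corrProd_incl]) t

theorem actR_corrProd (dot : A →ₗ[k] A →ₗ[k] A) (a : A) (t : A ⊗[k] A) :
    actR (corrProd dot) T (incl k A a) (incl₂ t) = inclPoly (onR (dot a) t) :=
  tensor₂_ext (f := actR (corrProd dot) T (incl k A a) ∘ₗ incl₂) (g := inclPoly ∘ₗ onR (dot a))
    (fun x y => by simp [incl₂, inclPoly, actR_tmul, corrProd_incl]) t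

theorem actL_corrBracket (circ br : A →ₗ[k] A →ₗ[k] A) (a : A) (t : A ⊗[k] A) :
    actL (corrBracket circ br) T (incl k A a) (incl₂ t) =
      delLPoly k _ (inclPoly (onL (circ.flip a) t)) +
        T (inclPoly (onL (circ a) t + onL (circ.flip a) t)) + inclPoly (onL (br a) t) :=
  tensor₂_ext (f := actL (corrBracket circ br) T (incl k A a) ∘ₗ incl₂)
    (g := delLPoly k _ ∘ₗ inclPoly ∘ₗ onL (circ.flip a) +
        T ∘ₗ inclPoly ∘ₗ (onL (circ a) + onL (circ.flip a)) + inclPoly ∘ₗ onL (br a))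
    (fun x y => by
      simp [incl₂, inclPoly, actL_tmul, corrBracket_incl, subst_lam, delPoly_const, delLPoly_const,
        delL]
      abel) t

theorem actR_corrBracket (circ br : A →ₗ[k] A →ₗ[k] A) (a : A) (t : A ⊗[k] A) :
    actR (corrBracket circ br) T (incl k A a) (incl₂ t) =
      delRPoly k _ (inclPoly (onR (circ.flip a) t)) +
        T (inclPoly (onR (circ a) t + onR (circ.flip a) t)) + inclPoly (onR (br a) t) :=
  tensor₂_ext (f := actR (corrBracket circ br) T (incl k A a) ∘ₗ incl₂)
    (g := delRPoly k _ ∘ₗ inclPoly ∘ₗ onR (circ.flip a) +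
        T ∘ₗ inclPoly ∘ₗ (onR (circ a) + onR (circ.flip a)) + inclPoly ∘ₗ onR (br a))
    (fun x y => by
      simp [incl₂, inclPoly, actR_tmul, corrBracket_incl, subst_lam, delPoly_const, delRPoly_const,
        delR]
      abel) t

theorem lTensor_flip₂_inclPoly (t : A ⊗[k] A) :
    (flip₂ (k := k) (V := Free k A)).lTensor k[X] (inclPoly t) = inclPoly (flip₂ t) := by
  rw [inclPoly, LinearMap.comp_apply, lTensor_const, flip₂_incl₂]; rfl

theorem const_incl₂ (t : A ⊗[k] A) : const k _ (incl₂ t) = inclPoly t := rfl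

end Free

/-! ### The associative and the Lie compatibility conditions. -/

section Compatibility

variable {k : Type*} [Field k] {A : Type*} [AddCommGroup A] [Module k A]
  {circ dot br : A →ₗ[k] A →ₗ[k] A} {Δ₁ Δ₂ δ₀ : A →ₗ[k] A ⊗[k] A}

theorem lTensor_corrProd (D : Free k A →ₗ[k] Free k A ⊗[k] Free k A) (a b : A) :
    D.lTensor k[X] (corrProd dot (incl k A a) (incl k A b)) = const k _ (D (incl k A (dot a b))) := by
  rw [corrProd_incl, lTensor_const]

theorem lTensor_corrBracket {D : Free k A →ₗ[k] Free k A ⊗[k] Free k A} (hD : IsDelHom D)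
    (a b : A) :
    D.lTensor k[X] (corrBracket circ br (incl k A a) (incl k A b)) =
      delLPoly k _ (const k _ (D (incl k A (circ b a)))) +
        delRPoly k _ (const k _ (D (incl k A (circ b a)))) +
        lam k _ (const k _ (D (incl k A (circ b a))) + const k _ (D (incl k A (circ a b)))) +
        const k _ (D (incl k A (br a b))) := by
  simp only [corrBracket_incl, map_add, lTensor_delPoly hD, lTensor_lam, lTensor_const]

theorem const_corrCobracket (a : A) :
    const k _ (corrCobracket Δ₁ δ₀ (incl k A a)) =
      delLPoly k _ (inclPoly (Δ₁ a)) - delRPoly k _ (inclPoly (flip₂ (Δ₁ a))) +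
        inclPoly (δ₀ a) := by
  simp only [corrCobracket_incl, map_add, map_sub, ← delLPoly_const, ← delRPoly_const,
    const_incl₂]

theorem asi_compat_iff :
    (∀ a b, (corrComul Δ₂).lTensor k[X] (corrProd dot a b) =
      actR (corrProd dot) (lamT k _) a (corrComul Δ₂ b) +
        actL (corrProd dot) (negLamDel k _) b (corrComul Δ₂ a)) ↔
    ∀ a b, Δ₂ (dot a b) = onR (dot a) (Δ₂ b) + onL (dot b) (Δ₂ a) := by
  have hd := isDelHom_corrComul Δ₂
  have hm := isSesquilinear_corrProd dot
  have key : ∀ a b, (corrComul Δ₂).lTensor k[X] (corrProd dot (incl k A a) (incl k A b)) -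
      (actR (corrProd dot) (lamT k _) (incl k A a) (corrComul Δ₂ (incl k A b)) +
        actL (corrProd dot) (negLamDel k _) (incl k A b) (corrComul Δ₂ (incl k A a))) =
      inclPoly (Δ₂ (dot a b) - (onR (dot a) (Δ₂ b) + onL (dot b) (Δ₂ a))) := fun a b => by
    simp only [lTensor_corrProd, corrComul_incl, actL_corrProd, actR_corrProd, const_incl₂, map_sub,
      map_add]
  refine ⟨fun h a b => ?_, fun h => ?_⟩
  · have := key a b
    rw [h, sub_self] at this
    have h' := isCoeff_poly.base (Δ₂ (dot a b) - (onR (dot a) (Δ₂ b) + onL (dot b) (Δ₂ a)))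
    rw [← this, map_zero] at h'
    exact sub_eq_zero.1 h'.symm
  · refine IsSesquilinear₂.ext (.lTensor hd hm) ((IsSesquilinear₂.actR_lam hd hm).add
      (.actL_negLamDel hd hm)) fun a b => ?_
    rw [key, h, sub_self, map_zero]

/-- The left side of `h` is symmetric in `a` and `b`; equating the right sides for `(a, b)` and `(b,
a)` is the claim on `A`, once `flip₂` is moved past the symmetric `Δ₂`. -/
theorem asi_compat_symm (hd : ∀ a b, dot a b = dot b a) (hΔ : ∀ a, Δ₂ a = flip₂ (Δ₂ a))
    (h : ∀ a b, Δ₂ (dot a b) = onR (dot a) (Δ₂ b) + onL (dot b) (Δ₂ a)) (a b : Free k A) :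
    (actL (corrProd dot) (negLamDel k _) b (corrComul Δ₂ a) -
      actR (corrProd dot) (negLamDel k _) b (corrComul Δ₂ a)) +
      (flip₂ (k := k) (V := Free k A)).lTensor k[X]
        (actL (corrProd dot) (lamT k _) a (corrComul Δ₂ b) -
          actR (corrProd dot) (lamT k _) a (corrComul Δ₂ b)) = 0 := by
  have hD := isDelHom_corrComul Δ₂
  have hm := isSesquilinear_corrProd dot
  refine ((((IsSesquilinear₂.actL_negLamDel hD hm).sub (.actR_negLamDel hD hm)).add
    ((IsSesquilinear₂.actL_lam hD hm).sub (.actR_lam hD hm)).flip).ext .zero fun a b => ?_) a b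
  have h1 := h a b
  rw [hd a b, h b a] at h1
  have h2 : onL (dot b) (Δ₂ a) - onR (dot b) (Δ₂ a) + flip₂ (onL (dot a) (Δ₂ b) -
      onR (dot a) (Δ₂ b)) = 0 := by
    rw [map_sub, flip₂_onL, flip₂_onR, ← hΔ]
    linear_combination (norm := module) -h1
  simp only [corrComul_incl, actL_corrProd, actR_corrProd, ← map_sub, lTensor_flip₂_inclPoly,
    ← map_add, h2, map_zero, sub_zero]

set_option maxHeartbeats 1000000 in
-- The five conditions are read off at `1`, `∂ ⊗ I`, `(∂ ⊗ I)²`, `λ²` and `(∂ ⊗ I)(I ⊗ ∂)`, in this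
-- order. The other five coefficients are combinations of these conditions, their flips and their
-- forms with `a` and `b` exchanged.
theorem lie_compat_iff (hbr : ∀ a b, br a b = -br b a) (hδ : ∀ a, δ₀ a = -flip₂ (δ₀ a)) :
    (∀ a b, (corrCobracket Δ₁ δ₀).lTensor k[X] (corrBracket circ br a b) =
      (actL (corrBracket circ br) (lamT k _) a (corrCobracket Δ₁ δ₀ b) +
        actR (corrBracket circ br) (lamT k _) a (corrCobracket Δ₁ δ₀ b)) -
      (actL (corrBracket circ br) (negLamDel k _) b (corrCobracket Δ₁ δ₀ a) +
        actR (corrBracket circ br) (negLamDel k _) b (corrCobracket Δ₁ δ₀ a))) ↔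
    ((∀ a b, δ₀ (br a b) =
      (onL (br a) (δ₀ b) + onR (br a) (δ₀ b)) - (onL (br b) (δ₀ a) + onR (br b) (δ₀ a))) ∧
    (∀ a b, δ₀ (circ b a) + Δ₁ (br a b) =
      onL (circ.flip a) (δ₀ b) + onL (circ b) (δ₀ a) + onR (star circ b) (δ₀ a) +
        (onL (br a) (Δ₁ b) + onR (br a) (Δ₁ b)) - onR (br b) (Δ₁ a + flip₂ (Δ₁ a))) ∧
    (∀ a b, Δ₁ (circ a b) = onL (circ.flip b) (Δ₁ a) + onR (star circ a) (Δ₁ b + flip₂ (Δ₁ b))) ∧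
    (∀ a b, onL (star circ a) (Δ₁ b) - onR (star circ a) (flip₂ (Δ₁ b)) =
      onL (star circ b) (Δ₁ a) - onR (star circ b) (flip₂ (Δ₁ a))) ∧
    (∀ a b, onR (circ.flip a) (Δ₁ b + flip₂ (Δ₁ b)) - onL (circ.flip a) (Δ₁ b + flip₂ (Δ₁ b)) =
      onR (circ.flip b) (Δ₁ a + flip₂ (Δ₁ a)) - onL (circ.flip b) (Δ₁ a + flip₂ (Δ₁ a)))) := by
  have hd := isDelHom_corrCobracket Δ₁ δ₀
  have hb := isSesquilinear_corrBracket circ br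
  have hδ' : ∀ a, flip₂ (δ₀ a) = -δ₀ a := fun a => by
    conv_rhs => rw [hδ a, neg_neg]
  have key : ∀ a b,
      (corrCobracket Δ₁ δ₀).lTensor k[X] (corrBracket circ br (incl k A a) (incl k A b)) -
      ((actL (corrBracket circ br) (lamT k _) (incl k A a) (corrCobracket Δ₁ δ₀ (incl k A b)) +
        actR (corrBracket circ br) (lamT k _) (incl k A a) (corrCobracket Δ₁ δ₀ (incl k A b))) -
      (actL (corrBracket circ br) (negLamDel k _) (incl k A b) (corrCobracket Δ₁ δ₀ (incl k A a)) +
        actR (corrBracket circ br) (negLamDel k _) (incl k A b)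
          (corrCobracket Δ₁ δ₀ (incl k A a)))) =
      quad (lam k _) (delLPoly k _) (delRPoly k _) inclPoly
        (δ₀ (br a b) - ((onL (br a) (δ₀ b) + onR (br a) (δ₀ b)) -
          (onL (br b) (δ₀ a) + onR (br b) (δ₀ a))))
        (δ₀ (circ b a) + δ₀ (circ a b) - onL (br a) (Δ₁ b) - onL (star circ a) (δ₀ b) +
          onR (br a) (flip₂ (Δ₁ b)) - onR (star circ a) (δ₀ b) - onL (br b) (Δ₁ a) -
          onL (star circ b) (δ₀ a) + onR (br b) (flip₂ (Δ₁ a)) - onR (star circ b) (δ₀ a))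
        (δ₀ (circ b a) + Δ₁ (br a b) - (onL (br a) (Δ₁ b) + onL (circ.flip a) (δ₀ b) +
          onR (br a) (Δ₁ b)) + (onL (circ.flip b) (δ₀ a) - onL (star circ b) (δ₀ a) +
          onR (br b) (Δ₁ a) + onR (br b) (flip₂ (Δ₁ a)) - onR (star circ b) (δ₀ a)))
        (δ₀ (circ b a) - flip₂ (Δ₁ (br a b)) - (-onL (br a) (flip₂ (Δ₁ b)) -
          onR (br a) (flip₂ (Δ₁ b)) + onR (circ.flip a) (δ₀ b)) + (-onL (br b) (Δ₁ a) -
          onL (br b) (flip₂ (Δ₁ a)) + onR (circ.flip b) (δ₀ a) - onL (star circ b) (δ₀ a) -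
          onR (star circ b) (δ₀ a)))
        (-(onL (star circ a) (Δ₁ b) - onR (star circ a) (flip₂ (Δ₁ b))) +
          (onL (star circ b) (Δ₁ a) - onR (star circ b) (flip₂ (Δ₁ a))))
        (Δ₁ (circ b a) + Δ₁ (circ a b) - (onL (star circ a) (Δ₁ b) + onL (circ.flip a) (Δ₁ b) +
          onR (star circ a) (Δ₁ b)) + (-onL (circ.flip b) (Δ₁ a) + onL (star circ b) (Δ₁ a) -
          onR (star circ b) (Δ₁ a) - (onR (star circ b) (flip₂ (Δ₁ a)) + onR (star circ b) (flip₂ (Δ₁ a)))))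
        (-flip₂ (Δ₁ (circ b a)) - flip₂ (Δ₁ (circ a b)) - (-onL (star circ a) (flip₂ (Δ₁ b)) -
          onR (star circ a) (flip₂ (Δ₁ b)) - onR (circ.flip a) (flip₂ (Δ₁ b))) +
          ((onL (star circ b) (Δ₁ a) + onL (star circ b) (Δ₁ a)) + onL (star circ b) (flip₂ (Δ₁ a)) +
          onR (circ.flip b) (flip₂ (Δ₁ a)) - onR (star circ b) (flip₂ (Δ₁ a))))
        (Δ₁ (circ b a) - onL (circ.flip a) (Δ₁ b) - onR (star circ b) (Δ₁ a) -
          onR (star circ b) (flip₂ (Δ₁ a)))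
        (Δ₁ (circ b a) - flip₂ (Δ₁ (circ b a)) - (-onL (circ.flip a) (flip₂ (Δ₁ b)) +
          onR (circ.flip a) (Δ₁ b)) + (-onL (circ.flip b) (Δ₁ a) + onL (star circ b) (Δ₁ a) -
          onL (circ.flip b) (flip₂ (Δ₁ a)) + onL (star circ b) (flip₂ (Δ₁ a)) +
          onR (circ.flip b) (Δ₁ a) - onR (star circ b) (Δ₁ a) +
          onR (circ.flip b) (flip₂ (Δ₁ a)) - onR (star circ b) (flip₂ (Δ₁ a))))
        (-flip₂ (Δ₁ (circ b a)) + onR (circ.flip a) (flip₂ (Δ₁ b)) + onL (star circ b) (Δ₁ a) +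
          onL (star circ b) (flip₂ (Δ₁ a))) := fun a b => by
    rw [lTensor_corrBracket hd]
    simp only [const_corrCobracket]
    simp only [corrCobracket_incl, map_add, map_sub,
      actL_delL hb delLPoly_lam, actL_delR delRPoly_lam, actR_delL delLPoly_lam,
      actR_delR hb delRPoly_lam, actL_delL hb delLPoly_negLamDel, actL_delR delRPoly_negLamDel,
      actR_delL delLPoly_negLamDel, actR_delR hb delRPoly_negLamDel, actL_corrBracket,
      actR_corrBracket]
    -- Only here is `ν` expanded; before, it has to stay a single operator for the rules of the
    -- actions to apply. The operators are then sorted into the order used by `quad`.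
    simp only [quad, map_add, map_sub, map_neg, negLamDel_apply, delLPoly_lam,
      delRPoly_lam, delRPoly_delLPoly, onL_star, onR_star]
    abel
  constructor
  · intro h
    have h' := fun a b => isCoeff_poly.quad_eq_zero_iff.1
      ((key a b).symm.trans (by rw [h, sub_self]))
    -- This is isolated first because the coefficient of `(∂ ⊗ I)(I ⊗ ∂)` gives the last condition
    -- only after `Δ₁ (circ b a)` and its flip are eliminated.
    have N : ∀ a b, Δ₁ (circ a b) =
        onL (circ.flip b) (Δ₁ a) + onR (star circ a) (Δ₁ b + flip₂ (Δ₁ b)) := fun a b => by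
      obtain ⟨-, -, -, -, -, -, -, e, -, -⟩ := h' b a
      rw [map_add]
      linear_combination (norm := module) e
    refine ⟨fun a b => ?_, fun a b => ?_, N, fun a b => ?_, fun a b => ?_⟩
    · exact sub_eq_zero.1 (h' a b).1
    · obtain ⟨-, -, e, -, -, -, -, -, -, -⟩ := h' a b
      simp only [onL_star, onR_star, map_add] at e ⊢
      linear_combination (norm := module) e
    · obtain ⟨-, -, -, -, e, -, -, -, -, -⟩ := h' a b
      linear_combination (norm := module) -e
    · obtain ⟨-, -, -, -, -, -, -, -, e, -⟩ := h' a b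
      have n := N b a
      have n' := congrArg flip₂ n
      simp only [map_add, flip₂_onL, flip₂_onR, flip₂_flip₂] at n n' ⊢
      linear_combination (norm := module) n - n' - e
  · rintro ⟨h₀, G, N₁, N₂, N₃⟩
    refine IsSesquilinear₂.ext (.lTensor hd hb) (((IsSesquilinear₂.actL_lam hd hb).add
      (.actR_lam hd hb)).sub ((IsSesquilinear₂.actL_negLamDel hd hb).add
      (.actR_negLamDel hd hb))) fun a b => ?_
    rw [key, isCoeff_poly.quad_eq_zero_iff]
    have g := G a b
    have g₁ := G b a
    have g' := congrArg flip₂ g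
    have n := N₁ a b
    have n₁ := N₁ b a
    have n' := congrArg flip₂ n
    have n₁' := congrArg flip₂ n₁
    have n₂ := N₂ a b
    have n₃ := N₃ a b
    -- With this sign `Δ₁ (br a b)` cancels in `g + g₁`, as it must, since it does not occur in the
    -- coefficient of `λ`.
    rw [hbr b a] at g₁
    simp only [map_add, map_sub, map_neg, flip₂_onL, flip₂_onR, flip₂_flip₂, hδ', onL_star,
      onR_star] at g g₁ g' n n₁ n' n₁' n₂ n₃ ⊢
    refine ⟨sub_eq_zero.2 (h₀ a b), ?_, ?_, ?_, ?_, ?_, ?_, ?_, ?_, ?_⟩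
    · linear_combination (norm := module) g + g₁
    · linear_combination (norm := module) g
    · linear_combination (norm := module) -g'
    · linear_combination (norm := module) -n₂
    · linear_combination (norm := module) n + n₁ - n₂
    · linear_combination (norm := module) -n' - n₁' - n₂
    · linear_combination (norm := module) n₁
    · linear_combination (norm := module) n₁ - n₁' - n₃
    · linear_combination (norm := module) -n₁'

end Compatibility

/-! ### The mixed compatibility conditions. -/

section Compatibility

variable {k : Type*} [Field k] {A : Type*} [AddCommGroup A] [Module k A]
  {circ dot br : A →ₗ[k] A →ₗ[k] A} {Δ₁ Δ₂ δ₀ : A →ₗ[k] A ⊗[k] A}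

/-- The two conformal conditions are treated together because the last finite condition comes from
neither alone: it combines the `I ⊗ ∂` coefficient of the first with the formulas for `Δ₁ (dot a b)`
and `Δ₂ (circ a b)`, which are the `∂ ⊗ I` coefficients of the first and the second. -/
theorem poisson_compat_iff (hdot : ∀ a b, dot a b = dot b a) (hΔ : ∀ a, Δ₂ a = flip₂ (Δ₂ a)) :
    ((∀ a b, (corrCobracket Δ₁ δ₀).lTensor k[X] (corrProd dot a b) =
      actL (corrProd dot) (lamT k _) a (corrCobracket Δ₁ δ₀ b) +
        actL (corrProd dot) (negLamDel k _) b (corrCobracket Δ₁ δ₀ a) +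
        actR (corrBracket circ br) (lamT k _) a (corrComul Δ₂ b) +
        actR (corrBracket circ br) (negLamDel k _) b (corrComul Δ₂ a)) ∧
    (∀ a b, (corrComul Δ₂).lTensor k[X] (corrBracket circ br a b) =
      (actL (corrBracket circ br) (lamT k _) a (corrComul Δ₂ b) +
        actR (corrBracket circ br) (lamT k _) a (corrComul Δ₂ b)) -
        actR (corrProd dot) (negLamDel k _) b (corrCobracket Δ₁ δ₀ a) +
        actL (corrProd dot) (negLamDel k _) b (corrCobracket Δ₁ δ₀ a))) ↔
    ((∀ a b, δ₀ (dot a b) =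
      onL (dot a) (δ₀ b) + onL (dot b) (δ₀ a) + onR (br a) (Δ₂ b) + onR (br b) (Δ₂ a)) ∧
    (∀ a b, Δ₂ (br a b) =
      (onL (br a) (Δ₂ b) + onR (br a) (Δ₂ b)) - onR (dot b) (δ₀ a) + onL (dot b) (δ₀ a)) ∧
    (∀ a b, Δ₁ (dot a b) = onL (dot a) (Δ₁ b) - onR (star circ b) (Δ₂ a)) ∧
    (∀ a b, Δ₂ (circ a b) = onL (circ.flip b) (Δ₂ a) - onR (dot a) (Δ₁ b + flip₂ (Δ₁ b))) ∧
    (∀ a b, onL (circ a) (Δ₂ b) + onR (circ b) (Δ₂ a) + onR (dot b) (Δ₁ a) +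
      onL (dot a) (flip₂ (Δ₁ b)) = 0)) := by
  have hd := isDelHom_corrCobracket Δ₁ δ₀
  have hD := isDelHom_corrComul Δ₂
  have hb := isSesquilinear_corrBracket circ br
  have hm := isSesquilinear_corrProd dot
  have hΔ' : ∀ a, flip₂ (Δ₂ a) = Δ₂ a := fun a => (hΔ a).symm
  have key₁ : ∀ a b,
      (corrCobracket Δ₁ δ₀).lTensor k[X] (corrProd dot (incl k A a) (incl k A b)) -
      (actL (corrProd dot) (lamT k _) (incl k A a) (corrCobracket Δ₁ δ₀ (incl k A b)) +
        actL (corrProd dot) (negLamDel k _) (incl k A b) (corrCobracket Δ₁ δ₀ (incl k A a)) +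
        actR (corrBracket circ br) (lamT k _) (incl k A a) (corrComul Δ₂ (incl k A b)) +
        actR (corrBracket circ br) (negLamDel k _) (incl k A b) (corrComul Δ₂ (incl k A a))) =
      quad (lam k _) (delLPoly k _) (delRPoly k _) inclPoly
        (δ₀ (dot a b) - (onL (dot a) (δ₀ b) + onL (dot b) (δ₀ a) + onR (br a) (Δ₂ b) +
          onR (br b) (Δ₂ a)))
        (-onL (dot a) (Δ₁ b) + onL (dot b) (Δ₁ a) - onR (star circ a) (Δ₂ b) +
          onR (star circ b) (Δ₂ a))
        (Δ₁ (dot a b) - onL (dot a) (Δ₁ b) + onR (star circ b) (Δ₂ a))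
        (-flip₂ (Δ₁ (dot a b)) + onL (dot a) (flip₂ (Δ₁ b)) + onL (dot b) (Δ₁ a) +
          onL (dot b) (flip₂ (Δ₁ a)) - onR (circ.flip a) (Δ₂ b) - onR (circ.flip b) (Δ₂ a) +
          onR (star circ b) (Δ₂ a))
        0 0 0 0 0 0 := fun a b => by
    rw [lTensor_corrProd, const_corrCobracket]
    simp only [corrCobracket_incl, corrComul_incl, map_add, map_sub,
      actL_delL hm delLPoly_lam, actL_delR delRPoly_lam, actL_delL hm delLPoly_negLamDel,
      actL_delR delRPoly_negLamDel, actL_corrProd, actR_corrBracket]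
    simp only [quad, map_add, map_sub, map_neg, map_zero, negLamDel_apply, onR_star]
    abel
  have key₂ : ∀ a b,
      (corrComul Δ₂).lTensor k[X] (corrBracket circ br (incl k A a) (incl k A b)) -
      ((actL (corrBracket circ br) (lamT k _) (incl k A a) (corrComul Δ₂ (incl k A b)) +
        actR (corrBracket circ br) (lamT k _) (incl k A a) (corrComul Δ₂ (incl k A b))) -
        actR (corrProd dot) (negLamDel k _) (incl k A b) (corrCobracket Δ₁ δ₀ (incl k A a)) +
        actL (corrProd dot) (negLamDel k _) (incl k A b) (corrCobracket Δ₁ δ₀ (incl k A a))) =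
      quad (lam k _) (delLPoly k _) (delRPoly k _) inclPoly
        (Δ₂ (br a b) - ((onL (br a) (Δ₂ b) + onR (br a) (Δ₂ b)) - onR (dot b) (δ₀ a) +
          onL (dot b) (δ₀ a)))
        (Δ₂ (circ b a) + Δ₂ (circ a b) - onL (star circ a) (Δ₂ b) - onR (star circ a) (Δ₂ b) +
          onR (dot b) (flip₂ (Δ₁ a)) + onL (dot b) (Δ₁ a))
        (Δ₂ (circ b a) - onL (circ.flip a) (Δ₂ b) + onR (dot b) (Δ₁ a) +
          onR (dot b) (flip₂ (Δ₁ a)))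
        (Δ₂ (circ b a) - onR (circ.flip a) (Δ₂ b) + onL (dot b) (Δ₁ a) +
          onL (dot b) (flip₂ (Δ₁ a)))
        0 0 0 0 0 0 := fun a b => by
    rw [lTensor_corrBracket hD]
    simp only [corrCobracket_incl, corrComul_incl, map_add, map_sub, const_incl₂,
      actR_delL delLPoly_negLamDel, actR_delR hm delRPoly_negLamDel, actL_delL hm delLPoly_negLamDel,
      actL_delR delRPoly_negLamDel, actL_corrProd, actR_corrProd, actL_corrBracket,
      actR_corrBracket]
    simp only [quad, map_add, map_sub, map_zero, negLamDel_apply, onL_star, onR_star]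
    abel
  constructor
  · rintro ⟨h₁, h₂⟩
    have h₁' := fun a b => isCoeff_poly.quad_eq_zero_iff.1
      ((key₁ a b).symm.trans (by rw [h₁, sub_self]))
    have h₂' := fun a b => isCoeff_poly.quad_eq_zero_iff.1
      ((key₂ a b).symm.trans (by rw [h₂, sub_self]))
    have c₁ : ∀ a b, Δ₁ (dot a b) = onL (dot a) (Δ₁ b) - onR (star circ b) (Δ₂ a) :=
      fun a b => by linear_combination (norm := module) (h₁' a b).2.2.1
    have c₂ : ∀ a b, Δ₂ (circ a b) =
        onL (circ.flip b) (Δ₂ a) - onR (dot a) (Δ₁ b + flip₂ (Δ₁ b)) := fun a b => by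
      rw [map_add]
      linear_combination (norm := module) (h₂' b a).2.2.1
    refine ⟨fun a b => sub_eq_zero.1 (h₁' a b).1, fun a b => sub_eq_zero.1 (h₂' a b).1, c₁, c₂,
      fun a b => ?_⟩
    have e := (h₁' a b).2.2.2.1
    have f := congrArg flip₂ (c₁ b a)
    have g := c₂ b a
    have g' := congrArg flip₂ g
    rw [hdot b a] at f
    simp only [map_add, map_sub, flip₂_onL, flip₂_onR, flip₂_flip₂, hΔ', onR_star]
      at e f g g' ⊢
    -- Adding `f` removes the flip of `Δ₁ (dot a b)` from `e`; in `g - g'` the left sides cancel by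
    -- cocommutativity of `Δ₂`.
    linear_combination (norm := module) e + f - g' + g
  · rintro ⟨h₁, h₂, c₁, c₂, c₃⟩
    refine ⟨IsSesquilinear₂.ext (.lTensor hd hm) ((((IsSesquilinear₂.actL_lam hd hm).add
      (.actL_negLamDel hd hm)).add (.actR_lam hD hb)).add (.actR_negLamDel hD hb)) fun a b => ?_,
      IsSesquilinear₂.ext (.lTensor hD hb) ((((IsSesquilinear₂.actL_lam hD hb).add
      (.actR_lam hD hb)).sub (.actR_negLamDel hd hm)).add (.actL_negLamDel hd hm)) fun a b => ?_⟩
    all_goals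
      have f := c₁ a b
      have f₁ := c₁ b a
      have f₁' := congrArg flip₂ f₁
      have g := c₂ b a
      have g' := congrArg flip₂ g
      have g₁' := congrArg flip₂ (c₂ a b)
      have c := c₃ a b
      rw [hdot b a] at f₁ f₁'
      simp only [map_add, map_sub, flip₂_onL, flip₂_onR, flip₂_flip₂, hΔ', onR_star]
        at f f₁ f₁' g g' g₁' c
    · rw [key₁, isCoeff_poly.quad_eq_zero_iff]
      simp only [onR_star]
      refine ⟨sub_eq_zero.2 (h₁ a b), ?_, ?_, ?_, trivial, trivial, trivial, trivial, trivial,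
        trivial⟩
      · linear_combination (norm := module) f - f₁
      · linear_combination (norm := module) f
      · linear_combination (norm := module) c + g' - g - f₁'
    · rw [key₂, isCoeff_poly.quad_eq_zero_iff]
      simp only [onL_star, onR_star]
      refine ⟨sub_eq_zero.2 (h₂ a b), ?_, ?_, ?_, trivial, trivial, trivial, trivial, trivial,
        trivial⟩
      · linear_combination (norm := module) g + g₁' - c + f - f₁
      · linear_combination (norm := module) g
      · linear_combination (norm := module) g'

end Compatibility

end PGD

end

/-! ### Assembly of the equivalence. -/

theorem theorem5p11 {k : Type*} [Field k] [CharZero k] {A : Type*} [AddCommGroup A] [Module k A]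
    (circ dot br : A →ₗ[k] A →ₗ[k] A) (hA : PGD.IsPGDAlgebra circ dot br)
    (Δ₁ Δ₂ δ₀ : A →ₗ[k] A ⊗[k] A) :
    PGD.IsPoissonConformalBialgebra (PGD.corrBracket circ br) (PGD.corrProd dot)
        (PGD.corrCobracket Δ₁ δ₀) (PGD.corrComul Δ₂) ↔
      PGD.IsPGDBialgebra circ dot br Δ₁ Δ₂ δ₀ := by
  have hP := PGD.isPoissonConformalAlgebra_corr hA
  have hdot := hA.poisson.commAssoc.comm
  have hbr := hA.gd.lie.skew
  -- The associative conditions use right multiplication; by commutativity it agrees with left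
  -- multiplication, the form in which they were analysed.
  have hopp : PGD.oppProd (PGD.corrProd dot) = PGD.corrProd dot :=
    LinearMap.ext₂ fun a b => (PGD.corrProd_comm hdot a b).symm
  constructor
  · rintro ⟨-, hC, ⟨-, -, hL⟩, ⟨⟨-, -, hS, -⟩, -, -⟩, h₁, h₂⟩
    obtain ⟨cg, cp, cd⟩ := PGD.isPoissonConformalCoalgebra_corr_iff.1 hC
    rw [hopp] at hS
    obtain ⟨l₀, g, n₁, n₂, n₃⟩ := (PGD.lie_compat_iff hbr cg.lie.coskew).1 hL
    obtain ⟨p₁, p₂, d₁, d₂, d₃⟩ := (PGD.poisson_compat_iff hdot cp.cocommAssoc.cocomm).1 ⟨h₁, h₂⟩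
    have nov : PGD.IsNovikovBialgebra circ Δ₁ := ⟨hA.gd.novikov, cg.novikov, n₁, n₂, n₃⟩
    have lie : PGD.IsLieBialg br δ₀ := ⟨hA.gd.lie, cg.lie, l₀⟩
    have asi : PGD.IsCommCocommASIBialgebra dot Δ₂ :=
      ⟨hA.poisson.commAssoc, cp.cocommAssoc, PGD.asi_compat_iff.1 hS⟩
    exact ⟨⟨hA.gd, cg, nov, lie, g⟩, ⟨hA.poisson, cp, asi, lie, p₁, p₂⟩,
      ⟨hA.dnp, cd, nov, asi, d₁, d₂, d₃⟩⟩
  · rintro ⟨⟨-, cg, nov, lie, g⟩, ⟨-, cp, asi, -, p₁, p₂⟩, ⟨-, cd, -, -, d₁, d₂, d₃⟩⟩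
    have hΔ := cp.cocommAssoc.cocomm
    have hC := PGD.isPoissonConformalCoalgebra_corr_iff.2 ⟨cg, cp, cd⟩
    obtain ⟨h₁, h₂⟩ := (PGD.poisson_compat_iff hdot hΔ).2 ⟨p₁, p₂, d₁, d₂, d₃⟩
    refine ⟨hP, hC, ⟨hP.lie, hC.lie, (PGD.lie_compat_iff hbr cg.lie.coskew).2
      ⟨lie.compat, g, nov.compat₁, nov.compat₂, nov.compat₃⟩⟩,
      ⟨⟨hP.commAssoc.toIsAssocConformalAlgebra, hC.cocommAssoc.toIsAssocConformalCoalgebra,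
        ?_, ?_⟩, hP.commAssoc.comm, hC.cocommAssoc.cocomm⟩, h₁, h₂⟩
    · rw [hopp]
      exact PGD.asi_compat_iff.2 asi.compat
    · rw [hopp]
      exact PGD.asi_compat_symm hdot hΔ asi.compat
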